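/- **Multiserver queue with discouragements.** Let $S\ge 1$ be an integer and $\lambda,\mu>0$. Consider the birth and death process on $\{0,1,2,\dots\}$ with birth intensities $\lambda_n(t)=\lambda_n a(t)$ and death intensities $\mu_n(t)=\mu_n b(t)$, where $$\lambda_n=\begin{cases}\lambda,& n<S,\\ \dfrac{\lambda}{n-S+2},& n\ge S,\end{cases}\qquad \mu_n=\begin{cases} n\mu,& n\le S,\\ S\mu,& n>S.\end{cases}$$ The functions $a,b\ge 0$ are locally integrable on $[0,\infty)$ and asymptotically periodic: $a=a_1+a_2$, $b=b_1+b_2$ with $a_1(t+T_1)=a_1(t)$, $b_1(t+T_2)=b_1(t)$ for $t\ge 0$, where $T_1,T_2>0$, and $a_2(t),b_2(t)\to0$ as $t\to\infty$. Put $a_m=\frac1{T_1}\int_0^{T_1}a_1(u)\,du$ and $b_m=\frac1{T_2}\int_0^{T_2}b_1(u)\,du$. Let $\varepsilon\in(0,1)$ be such that $\mu b_m-\varepsilon\lambda a_m>0$, and put $$\delta_k=\begin{cases}1,&k<S,\\ 1+\varepsilon,&k\ge S,\end{cases}\qquad q_i=\sum_{j=0}^{i-1}\prod_{k=0}^{j}\delta_k,\qquad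 \kappa=\min\Big\{1,\frac{S\varepsilon}{1+\varepsilon}\Big\},\qquad \dot\alpha(t)=\kappa\,\big(\mu b(t)-\varepsilon\lambda a(t)\big).$$ If $(S-1)\varepsilon\le1$ (in particular, whenever $S\le 2$), then $\dot\alpha(t)=\frac{S\varepsilon}{1+\varepsilon}\big(\mu b(t)-\varepsilon\lambda a(t)\big)$. Moreover: 1. For all $k\ge0$ and $t\ge0$, $$\alpha_k(t):=\lambda_k(t)+\mu_{k+1}(t)-\delta_{k+1}\lambda_{k+1}(t)-\delta_k^{-1}\mu_k(t)\ \ge\ \dot\alpha(t).$$ 2. Let $\mathbf p^{1}(t),\mathbf p^{2}(t)$, $t\ge0$, be any two families of probability vectors that solve the forward Kolmogorov system of the process (in the integrated sense). Then for $0\le s\le t$, in the $l^1$ norm, $$\big\|\mathbf p^1(t)-\mathbf p^2(t)\big\|\le 4\,e^{-\int_s^t\dot\alpha(u)\,du}\sum_{i\ge1}q_i\,\big|p^1_i(s)-p^2_i(s)\big|$$ whenever the series on the right converges (otherwise there is nothing to claim). 3. The rate is exponential, and the process is weakly ergodic: for every $\eta<\kappa(\mu b_m-\varepsilon\lambda a_m)$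 there is a constant $K>0$ with $e^{-\int_s^t\dot\alpha(u)\,du}\le Ke^{-\eta(t-s)}$ for all $0\le s\le t$; and $\|\mathbf p^1(t)-\mathbf p^2(t)\|\to0$ as $t\to\infty$ for any two solutions as in 2. -/

import Mathlib

open MeasureTheory Filter Topology

noncomputable section

namespace BDP

/-- Right-hand side of the forward Kolmogorov system of the birth and death process on `ℕ` with
birth intensities `lam n * a t` and death intensities `mu n * b t`, at time `t`, for the vector of
state probabilities `x`. -/
def forwardRHS (lam mu : ℕ → ℝ) (a b : ℝ → ℝ) (t : ℝ) (x : ℕ → ℝ) : ℕ → ℝ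
  | 0 => mu 1 * b t * x 1 - (lam 0 * a t + mu 0 * b t) * x 0
  | n + 1 => lam n * a t * x n - (lam (n + 1) * a t + mu (n + 1) * b t) * x (n + 1)
      + mu (n + 2) * b t * x (n + 2)

/-- `p t n`, `t ≥ 0`, are the state probabilities of the process: `p t` is a probability vector for
every `t ≥ 0`, and `p` solves the forward Kolmogorov system. As `a` and `b` are only locally
integrable, the system is understood in the Carathéodory (integrated) sense. -/
structure IsStateProb (lam mu : ℕ → ℝ) (a b : ℝ → ℝ) (p : ℝ → ℕ → ℝ) : Prop where
  nonneg : ∀ t, 0 ≤ t → ∀ n, 0 ≤ p t n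
  hasSum_one : ∀ t, 0 ≤ t → HasSum (p t) 1
  continuousOn : ∀ n, ContinuousOn (fun t => p t n) (Set.Ici 0)
  forward : ∀ t, 0 ≤ t → ∀ n,
    p t n = p 0 n + ∫ u in (0 : ℝ)..t, forwardRHS lam mu a b u (p u) n

/-- The `l¹` norm of a difference of vectors (used for probability vectors only). -/
def l1dist (x y : ℕ → ℝ) : ℝ := ∑' n, |x n - y n|

/-- Any two solutions of the forward Kolmogorov system that consist of probability vectors
approach each other in `l¹`. -/
def WeaklyErgodic (lam mu : ℕ → ℝ) (a b : ℝ → ℝ) : Prop :=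
  ∀ p₁ p₂ : ℝ → ℕ → ℝ, IsStateProb lam mu a b p₁ → IsStateProb lam mu a b p₂ →
    Tendsto (fun t => l1dist (p₁ t) (p₂ t)) atTop (𝓝 0)

/-- `f` is nonnegative and locally integrable on `[0, ∞)`, and `f = f₁ + (f - f₁)` there, with
`f₁` periodic of period `T` and `f - f₁` tending to `0` at infinity. -/
structure IsAsympPeriodic (f f₁ : ℝ → ℝ) (T : ℝ) : Prop where
  nonneg : ∀ t, 0 ≤ t → 0 ≤ f t
  locallyIntegrable : LocallyIntegrableOn f (Set.Ici 0)
  period_pos : 0 < T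
  periodic : ∀ t, 0 ≤ t → f₁ (t + T) = f₁ t
  integrable : IntervalIntegrable f₁ volume 0 T
  tendsto : Tendsto (fun t => f t - f₁ t) atTop (𝓝 0)

/-- The mean value over one period. -/
def periodMean (f₁ : ℝ → ℝ) (T : ℝ) : ℝ := (1 / T) * ∫ u in (0 : ℝ)..T, f₁ u

/-- The quantities `α_k(t) = λ_k(t) + μ_{k+1}(t) - δ_{k+1} λ_{k+1}(t) - δ_k⁻¹ μ_k(t)`, where
`λ_k(t) = lam k * a t` and `μ_k(t) = mu k * b t` (the last term vanishes for `k = 0` if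
`mu 0 = 0`). -/
def alpha (lam mu δ : ℕ → ℝ) (a b : ℝ → ℝ) (k : ℕ) (t : ℝ) : ℝ :=
  lam k * a t + mu (k + 1) * b t - δ (k + 1) * (lam (k + 1) * a t) - (δ k)⁻¹ * (mu k * b t)

/-- `q_i = ∑_{m=0}^{i-1} ∏_{k=0}^{m} δ_k`. -/
def q (δ : ℕ → ℝ) (i : ℕ) : ℝ := ∑ m ∈ Finset.range i, ∏ k ∈ Finset.range (m + 1), δ k

/-- Arrival rates of the `S`-server queue with discouragements. -/
def discLam (S : ℕ) (l : ℝ) (n : ℕ) : ℝ := if n < S then l else l / ((n : ℝ) - (S : ℝ) + 2)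

/-- Service rates of the `S`-server queue. -/
def discMu (S : ℕ) (m : ℝ) (n : ℕ) : ℝ := if n ≤ S then (n : ℝ) * m else (S : ℝ) * m

/-- The weights `δ_k`. -/
def discDelta (S : ℕ) (ε : ℝ) (k : ℕ) : ℝ := if k < S then 1 else 1 + ε

/-- The rate constant `min {1, S ε / (1 + ε)}`. -/
def rateConst (S : ℕ) (ε : ℝ) : ℝ := min 1 ((S : ℝ) * ε / (1 + ε))

/-- The rate function `min {1, S ε / (1 + ε)} (m b(t) - ε l a(t))`. -/
def rate (S : ℕ) (l m ε : ℝ) (a b : ℝ → ℝ) (t : ℝ) : ℝ :=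
  rateConst S ε * (m * b t - ε * (l * a t))

end BDP

end

open MeasureTheory Filter Topology

namespace BDP

/-- The composition of a Lipschitz function with an absolutely continuous one is absolutely
continuous. -/
theorem absolutelyContinuous_comp {f φ : ℝ → ℝ} {s t : ℝ} {K : NNReal} {A : Set ℝ}
    (hφ : LipschitzOnWith K φ A) (hf : AbsolutelyContinuousOnInterval f s t)
    (hA : Set.MapsTo f (Set.uIcc s t) A) :
    AbsolutelyContinuousOnInterval (fun x => φ (f x)) s t := by
  rw [absolutelyContinuousOnInterval_iff] at hf ⊢
  intro e he
  obtain ⟨d, hd, h⟩ := hf (e / (K + 1)) (by positivity)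
  refine ⟨d, hd, fun E hE hlen => ?_⟩
  have h1 := h E hE hlen
  calc ∑ i ∈ Finset.range E.1, dist (φ (f (E.2 i).1)) (φ (f (E.2 i).2))
      ≤ ∑ i ∈ Finset.range E.1, K * dist (f (E.2 i).1) (f (E.2 i).2) :=
        Finset.sum_le_sum fun i hi =>
          hφ.dist_le_mul _ (hA (hE.1 i hi).1) _ (hA (hE.1 i hi).2)
    _ = K * ∑ i ∈ Finset.range E.1, dist (f (E.2 i).1) (f (E.2 i).2) := by
        rw [Finset.mul_sum]
    _ ≤ K * (e / (K + 1)) := by gcongr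
    _ < (K + 1) * (e / (K + 1)) := by gcongr; linarith
    _ = e := by field

theorem absolutelyContinuous_exp {f : ℝ → ℝ} {s t : ℝ}
    (hf : AbsolutelyContinuousOnInterval f s t) :
    AbsolutelyContinuousOnInterval (fun x => Real.exp (f x)) s t := by
  obtain ⟨C, hC⟩ := hf.exists_bound
  have hlip : LipschitzOnWith (Real.exp C).toNNReal Real.exp (Set.Icc (-C) C) := by
    refine Convex.lipschitzOnWith_of_nnnorm_deriv_le (fun x _ => Real.differentiableAt_exp)
      (fun x hx => ?_) (convex_Icc _ _)
    rw [← NNReal.coe_le_coe, coe_nnnorm, Real.deriv_exp, Real.norm_eq_abs, Real.abs_exp,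
      Real.coe_toNNReal _ (Real.exp_pos _).le]
    exact Real.exp_le_exp.2 hx.2
  exact absolutelyContinuous_comp hlip hf fun x hx => abs_le.1 (hC x hx)

theorem absolutelyContinuous_const (κ s t : ℝ) :
    AbsolutelyContinuousOnInterval (fun _ : ℝ => κ) s t :=
  LipschitzOnWith.absolutelyContinuousOnInterval (K := 0) (f := fun _ : ℝ => κ)
    (LipschitzWith.const κ).lipschitzOnWith

theorem absolutelyContinuous_sum {ι : Type*} (A : Finset ι) {f : ι → ℝ → ℝ} {s t : ℝ}
    (hf : ∀ i, AbsolutelyContinuousOnInterval (f i) s t) :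
    AbsolutelyContinuousOnInterval (fun x => ∑ i ∈ A, f i x) s t := by
  classical
  induction A using Finset.induction_on with
  | empty =>
    simpa using absolutelyContinuous_const 0 s t
  | insert i A hi ih =>
    simp only [Finset.sum_insert hi]
    exact (hf i).add ih

/-- A Grönwall inequality for absolutely continuous functions. -/
theorem gronwall_absolutelyContinuous {w c g : ℝ → ℝ} {s t : ℝ} (hst : s ≤ t)
    (hw : AbsolutelyContinuousOnInterval w s t) (hc : IntervalIntegrable c volume s t)
    (hg : IntervalIntegrable g volume s t)
    (h : ∀ᵐ u, u ∈ Set.uIcc s t → deriv w u ≤ -(c u) * w u + g u) :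
    Real.exp (∫ u in s..t, c u) * w t ≤
      w s + ∫ u in s..t, Real.exp (∫ x in s..u, c x) * g u := by
  have hC := hc.absolutelyContinuousOnInterval_intervalIntegral (c := s) (by simp)
  have hE := absolutelyContinuous_exp hC
  have hG := hE.fun_mul hw
  have key := hG.integral_deriv_eq_sub
  have hle : ∫ u in s..t, deriv (fun x => Real.exp (∫ y in s..x, c y) * w x) u ≤
      ∫ u in s..t, Real.exp (∫ x in s..u, c x) * g u := by
    have hae : ∀ᵐ u, u ∈ Set.Icc s t →
        deriv (fun x => Real.exp (∫ y in s..x, c y) * w x) u ≤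
          Real.exp (∫ x in s..u, c x) * g u := by
      filter_upwards [h, hw.ae_differentiableAt, hc.ae_hasDerivAt_integral] with u h1 h2 h3 hu
      rw [← Set.uIcc_of_le hst] at hu
      have hd := (((h3 hu s (by simp)).exp).mul (h2 hu).hasDerivAt)
      have hd' : deriv (fun x => Real.exp (∫ y in s..x, c y) * w x) u = _ := hd.deriv
      rw [hd']
      have := mul_le_mul_of_nonneg_left (h1 hu) (Real.exp_pos (∫ x in s..u, c x)).le
      nlinarith [this]
    rw [intervalIntegral.integral_of_le hst, intervalIntegral.integral_of_le hst]
    refine setIntegral_mono_on_ae ?_ ?_ measurableSet_Ioc ?_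
    · exact hG.intervalIntegrable_deriv.1
    · exact (hg.continuousOn_mul hE.continuousOn).1
    · filter_upwards [hae] with u hu hu' using hu ⟨hu'.1.le, hu'.2⟩
  rw [key] at hle
  simp only [intervalIntegral.integral_same, Real.exp_zero, one_mul] at hle
  linarith

theorem intervalIntegrable_of_Ici {f : ℝ → ℝ} (hf : LocallyIntegrableOn f (Set.Ici 0))
    {s t : ℝ} (hs : 0 ≤ s) (ht : 0 ≤ t) : IntervalIntegrable f volume s t := by
  have h : IntegrableOn f (Set.uIcc s t) :=
    hf.integrableOn_compact_subset (fun x hx => (le_min hs ht).trans hx.1) isCompact_uIcc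
  exact h.intervalIntegrable

/-- The weight `∏_{i ≤ k} δ_i`. -/
def weight (δ : ℕ → ℝ) (k : ℕ) : ℝ := ∏ i ∈ Finset.range (k + 1), δ i

theorem weight_succ (δ : ℕ → ℝ) (k : ℕ) : weight δ (k + 1) = weight δ k * δ (k + 1) :=
  Finset.prod_range_succ _ _

theorem weight_pos {δ : ℕ → ℝ} (hδ : ∀ k, 0 < δ k) (k : ℕ) : 0 < weight δ k :=
  Finset.prod_pos fun _ _ => hδ _

theorem one_le_weight {δ : ℕ → ℝ} (hδ : ∀ k, 1 ≤ δ k) (k : ℕ) : 1 ≤ weight δ k := by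
  induction k with
  | zero => simpa [weight] using hδ 0
  | succ k ih => rw [weight_succ]; nlinarith [hδ (k + 1)]

/-- A nonnegative subsolution, bounded by `1`, of the system
`z_{n+1}' = λ_n(t) (z_n - z_{n+1}) - μ_{n+1}(t) (z_{n+1} - z_{n+2})` satisfied by the tails of the
state probabilities, with boundary value `z_0` at most `r`. -/
structure IsSubsolution (lam mu : ℕ → ℝ) (a b : ℝ → ℝ) (r : ℝ) (v : ℝ → ℕ → ℝ) : Prop where
  ac : ∀ n s t, 0 ≤ s → s ≤ t → AbsolutelyContinuousOnInterval (fun u => v u n) s t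
  nonneg : ∀ u n, 0 ≤ v u n
  le_one : ∀ u, 0 ≤ u → ∀ n, v u n ≤ 1
  zero_le : ∀ u, 0 ≤ u → v u 0 ≤ r
  deriv_le : ∀ n, ∀ᵐ u, 0 ≤ u → deriv (fun x => v x (n + 1)) u ≤
    lam n * a u * (v u n - v u (n + 1)) - mu (n + 1) * b u * (v u (n + 1) - v u (n + 2))

/-- Summation by parts for the weighted sum of the right-hand sides. -/
theorem sum_weight_mul {lam mu δ : ℕ → ℝ} (a b : ℝ → ℝ) (t : ℝ) (hmu : mu 0 = 0)
    (hδ : ∀ k, δ k ≠ 0) (x : ℕ → ℝ) (N : ℕ) :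
    ∑ k ∈ Finset.range (N + 1), weight δ k * (lam k * a t * (x k - x (k + 1)) -
        mu (k + 1) * b t * (x (k + 1) - x (k + 2))) =
      -(∑ k ∈ Finset.range (N + 1), weight δ k * alpha lam mu δ a b k t * x (k + 1)) +
        weight δ 0 * lam 0 * a t * x 0 + weight δ N * mu (N + 1) * b t * x (N + 2) -
        weight δ (N + 1) * lam (N + 1) * a t * x (N + 1) := by
  induction N with
  | zero =>
    simp only [zero_add, Finset.sum_range_one, alpha, hmu, weight_succ]
    ring
  | succ N ih =>
    rw [Finset.sum_range_succ, ih, Finset.sum_range_succ (n := N + 1)]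
    have h1 : weight δ (N + 1) * (δ (N + 1))⁻¹ = weight δ N := by
      rw [weight_succ, mul_assoc, mul_inv_cancel₀ (hδ _), mul_one]
    rw [alpha, ← h1, weight_succ δ (N + 1)]
    ring

/-- The weighted sums of a subsolution. -/
def wsum (δ : ℕ → ℝ) (x : ℕ → ℝ) (N : ℕ) : ℝ :=
  ∑ k ∈ Finset.range (N + 1), weight δ k * x (k + 1)

theorem wsum_le_of_alpha_ge {lam mu δ : ℕ → ℝ} {a b c : ℝ → ℝ} {r : ℝ} {v : ℝ → ℕ → ℝ}
    (hv : IsSubsolution lam mu a b r v) (hlam : ∀ k, 0 ≤ lam k) (hmu : mu 0 = 0)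
    (hδ : ∀ k, 0 < δ k) (ha : LocallyIntegrableOn a (Set.Ici 0))
    (hb : LocallyIntegrableOn b (Set.Ici 0)) (hc : LocallyIntegrableOn c (Set.Ici 0))
    (ha0 : ∀ t, 0 ≤ t → 0 ≤ a t) (hα : ∀ k t, 0 ≤ t → c t ≤ alpha lam mu δ a b k t)
    {s t : ℝ} (hs : 0 ≤ s) (hst : s ≤ t) (N : ℕ) :
    Real.exp (∫ u in s..t, c u) * wsum δ (v t) N ≤ wsum δ (v s) N +
      ∫ u in s..t, Real.exp (∫ x in s..u, c x) *
        (weight δ 0 * lam 0 * r * a u + mu (N + 1) * (b u * (weight δ N * v u (N + 2)))) := by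
  have ht := hs.trans hst
  have hac : ∀ k, AbsolutelyContinuousOnInterval (fun u => weight δ k * v u (k + 1)) s t :=
    fun k => (hv.ac (k + 1) s t hs hst).const_mul _
  refine gronwall_absolutelyContinuous hst (absolutelyContinuous_sum _ hac)
    (intervalIntegrable_of_Ici hc hs ht) ?_ ?_
  · refine ((intervalIntegrable_of_Ici ha hs ht).const_mul _).add (IntervalIntegrable.const_mul ?_ _)
    exact (intervalIntegrable_of_Ici hb hs ht).mul_continuousOn
      ((hv.ac (N + 2) s t hs hst).const_mul _).continuousOn
  · filter_upwards [ae_all_iff.2 hv.deriv_le,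
      ae_all_iff.2 fun n => (hv.ac n s t hs hst).ae_differentiableAt] with u h1 h2 hu
    have hu0 : 0 ≤ u := by
      rw [Set.uIcc_of_le hst] at hu
      exact hs.trans hu.1
    have hd : deriv (fun x => wsum δ (v x) N) u =
        ∑ k ∈ Finset.range (N + 1), weight δ k * deriv (fun x => v x (k + 1)) u := by
      unfold wsum
      exact (HasDerivAt.fun_sum fun k _ => ((h2 (k + 1) hu).hasDerivAt.const_mul _)).deriv
    have hsum := sum_weight_mul (lam := lam) a b u hmu (fun k => (hδ k).ne') (v u) N
    have hle : deriv (fun x => wsum δ (v x) N) u ≤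
        ∑ k ∈ Finset.range (N + 1), weight δ k * (lam k * a u * (v u k - v u (k + 1)) -
          mu (k + 1) * b u * (v u (k + 1) - v u (k + 2))) := by
      rw [hd]
      exact Finset.sum_le_sum fun k _ => mul_le_mul_of_nonneg_left (h1 k hu0) (weight_pos hδ k).le
    have hαsum : c u * wsum δ (v u) N ≤
        ∑ k ∈ Finset.range (N + 1), weight δ k * alpha lam mu δ a b k u * v u (k + 1) := by
      rw [wsum, Finset.mul_sum]
      refine Finset.sum_le_sum fun k _ => ?_
      have := mul_le_mul_of_nonneg_right (hα k u hu0)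
        (mul_nonneg (weight_pos hδ k).le (hv.nonneg u (k + 1)))
      linarith
    have h0 : weight δ 0 * lam 0 * a u * v u 0 ≤ weight δ 0 * lam 0 * r * a u := by
      have := mul_le_mul_of_nonneg_left (hv.zero_le u hu0)
        (mul_nonneg (mul_nonneg (weight_pos hδ 0).le (hlam 0)) (ha0 u hu0))
      linarith
    have hN : 0 ≤ weight δ (N + 1) * lam (N + 1) * a u * v u (N + 1) :=
      mul_nonneg (mul_nonneg (mul_nonneg (weight_pos hδ _).le (hlam _)) (ha0 u hu0))
        (hv.nonneg _ _)
    change deriv (fun x => wsum δ (v x) N) u ≤ -(c u) * wsum δ (v u) N + _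
    linarith

/-- The sequence `δ` up to `R`, continued by `1 / 2`; its weights are summable. -/
noncomputable def cutoff (δ : ℕ → ℝ) (R k : ℕ) : ℝ := if k ≤ R then δ k else 1 / 2

theorem half_le_cutoff {δ : ℕ → ℝ} (hδ : ∀ k, 1 ≤ δ k) (R k : ℕ) : 1 / 2 ≤ cutoff δ R k := by
  unfold cutoff
  split_ifs
  · linarith [hδ k]
  · exact le_rfl

theorem cutoff_le {δ : ℕ → ℝ} (hδ : ∀ k, 1 ≤ δ k) (R k : ℕ) : cutoff δ R k ≤ δ k := by
  unfold cutoff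
  split_ifs
  · exact le_rfl
  · linarith [hδ k]

theorem weight_cutoff_le {δ : ℕ → ℝ} (hδ : ∀ k, 1 ≤ δ k) (R k : ℕ) :
    weight (cutoff δ R) k ≤ weight δ k :=
  Finset.prod_le_prod (fun i _ => by linarith [half_le_cutoff hδ R i]) fun i _ => cutoff_le hδ R i

theorem weight_cutoff_of_le (δ : ℕ → ℝ) {R k : ℕ} (h : k ≤ R) :
    weight (cutoff δ R) k = weight δ k := by
  refine Finset.prod_congr rfl fun i hi => ?_
  rw [cutoff, if_pos]
  have := Finset.mem_range.1 hi
  omega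

theorem tendsto_weight_cutoff (δ : ℕ → ℝ) (R : ℕ) :
    Tendsto (weight (cutoff δ R)) atTop (𝓝 0) := by
  have h : ∀ j, weight (cutoff δ R) (j + R) = weight δ R * (1 / 2) ^ j := by
    intro j
    induction j with
    | zero => simp [weight_cutoff_of_le]
    | succ j ih =>
      rw [show j + 1 + R = j + R + 1 by ring, weight_succ, ih, cutoff, if_neg (by omega)]
      ring
  rw [← tendsto_add_atTop_iff_nat R]
  simp only [h]
  simpa using (tendsto_pow_atTop_nhds_zero_of_lt_one (by norm_num : (0 : ℝ) ≤ 1 / 2)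
    (by norm_num)).const_mul (weight δ R)

/-- A lower bound for `α_k` that only uses that the ratios of the weights lie in `[1 / 2, 2]`. -/
theorem alpha_ge_crude {lam mu δ : ℕ → ℝ} {a b : ℝ → ℝ} {L M : ℝ}
    (hlam : ∀ k, 0 ≤ lam k) (hlamL : ∀ k, lam k ≤ L) (hmu0 : ∀ k, 0 ≤ mu k) (hmuM : ∀ k, mu k ≤ M)
    (h1 : ∀ k, 1 / 2 ≤ δ k) (h2 : ∀ k, δ k ≤ 2) {t : ℝ} (hat : 0 ≤ a t) (hbt : 0 ≤ b t) (k : ℕ) :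
    -(2 * L * a t + 2 * M * b t) ≤ alpha lam mu δ a b k t := by
  have hi : (δ k)⁻¹ ≤ 2 := by
    rw [inv_le_comm₀ (by linarith [h1 k]) two_pos]
    linarith [h1 k]
  have e1 := mul_nonneg (hlam k) hat
  have e2 := mul_nonneg (hmu0 (k + 1)) hbt
  have e3 : δ (k + 1) * (lam (k + 1) * a t) ≤ 2 * (L * a t) :=
    mul_le_mul (h2 _) (mul_le_mul_of_nonneg_right (hlamL _) hat) (mul_nonneg (hlam _) hat) two_pos.le
  have e4 : (δ k)⁻¹ * (mu k * b t) ≤ 2 * (M * b t) :=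
    mul_le_mul hi (mul_le_mul_of_nonneg_right (hmuM _) hbt) (mul_nonneg (hmu0 _) hbt) two_pos.le
  unfold alpha
  linarith

theorem wsum_mono {δ : ℕ → ℝ} (hδ : ∀ k, 0 < δ k) {x : ℕ → ℝ} (hx : ∀ n, 0 ≤ x n) :
    Monotone (wsum δ x) := by
  refine monotone_nat_of_le_succ fun N => ?_
  rw [wsum, wsum, Finset.sum_range_succ _ (N + 1)]
  linarith [mul_nonneg (weight_pos hδ (N + 1)).le (hx (N + 1 + 1))]

section

variable {lam mu δ : ℕ → ℝ} {a b : ℝ → ℝ} {r L M : ℝ} {v : ℝ → ℕ → ℝ}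

/-- The weighted sums of a subsolution remain bounded on bounded intervals. -/
theorem exists_wsum_bound
    (hv : IsSubsolution lam mu a b r v) (hlam : ∀ k, 0 ≤ lam k) (hlamL : ∀ k, lam k ≤ L)
    (hmu : mu 0 = 0) (hmu0 : ∀ k, 0 ≤ mu k) (hmuM : ∀ k, mu k ≤ M)
    (hδ : ∀ k, 1 ≤ δ k) (hδ2 : ∀ k, δ k ≤ 2) (ha : LocallyIntegrableOn a (Set.Ici 0))
    (hb : LocallyIntegrableOn b (Set.Ici 0)) (ha0 : ∀ t, 0 ≤ t → 0 ≤ a t)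
    (hb0 : ∀ t, 0 ≤ t → 0 ≤ b t) {W₀ s t : ℝ} (hs : 0 ≤ s)
    (hW : ∀ N, wsum δ (v s) N ≤ W₀) :
    ∃ B, ∀ u ∈ Set.Icc s t, ∀ N, wsum δ (v u) N ≤ B := by
  have hr : 0 ≤ r := (hv.nonneg 0 0).trans (hv.zero_le 0 le_rfl)
  have hL : 0 ≤ L := (hlam 0).trans (hlamL 0)
  have hM : 0 ≤ M := (hmu0 0).trans (hmuM 0)
  set f : ℝ → ℝ := fun u => 2 * L * a u + 2 * M * b u with hf
  have hfint : LocallyIntegrableOn f (Set.Ici 0) := by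
    have h1 : LocallyIntegrableOn (fun u => 2 * L * a u) (Set.Ici 0) := ha.smul (2 * L)
    have h2 : LocallyIntegrableOn (fun u => 2 * M * b u) (Set.Ici 0) := hb.smul (2 * M)
    exact h1.add h2
  have hf0 : ∀ u, 0 ≤ u → 0 ≤ f u := fun u hu =>
    add_nonneg (mul_nonneg (by linarith) (ha0 u hu)) (mul_nonneg (by linarith) (hb0 u hu))
  have hd0 : 0 < weight δ 0 := weight_pos (fun k => by linarith [hδ k]) 0
  have hδ0 : ∀ k, 0 < δ k := fun k => by linarith [hδ k]
  refine ⟨Real.exp (∫ x in s..t, f x) * (W₀ + weight δ 0 * lam 0 * r * ∫ x in s..t, a x),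
    fun u hu N => ?_⟩
  have hu0 : 0 ≤ u := hs.trans hu.1
  have ht : 0 ≤ t := hu0.trans hu.2
  have hcut : ∀ k, 0 < cutoff δ N k := fun k => by linarith [half_le_cutoff hδ N k]
  have hIa := intervalIntegrable_of_Ici ha hs hu0
  have hIb := intervalIntegrable_of_Ici hb hs hu0
  have hstep : ∀ N', N ≤ N' → Real.exp (-∫ x in s..u, f x) * wsum δ (v u) N ≤
      W₀ + weight δ 0 * lam 0 * r * (∫ x in s..u, a x) +
        weight (cutoff δ N) N' * (M * ∫ x in s..u, b x) := by
    intro N' hN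
    have key := wsum_le_of_alpha_ge (c := fun u => -f u) hv hlam hmu hcut ha hb hfint.neg ha0
      (fun k t ht => alpha_ge_crude hlam hlamL hmu0 hmuM (half_le_cutoff hδ N)
        (fun k => (cutoff_le hδ N k).trans (hδ2 k)) (ha0 t ht) (hb0 t ht) k) hs hu.1 N'
    have h1 : wsum δ (v u) N ≤ wsum (cutoff δ N) (v u) N' := by
      refine le_trans (le_of_eq ?_) (wsum_mono hcut (hv.nonneg u) hN)
      refine Finset.sum_congr rfl fun k hk => ?_
      rw [weight_cutoff_of_le δ (by have := Finset.mem_range.1 hk; omega)]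
    have h2 : wsum (cutoff δ N) (v s) N' ≤ W₀ := by
      refine le_trans (Finset.sum_le_sum fun k _ => ?_) (hW N')
      exact mul_le_mul_of_nonneg_right (weight_cutoff_le hδ N k) (hv.nonneg s _)
    have h3 : ∫ y in s..u, Real.exp (∫ x in s..y, -f x) *
        (weight (cutoff δ N) 0 * lam 0 * r * a y +
          mu (N' + 1) * (b y * (weight (cutoff δ N) N' * v y (N' + 2)))) ≤
        ∫ y in s..u, (weight δ 0 * lam 0 * r * a y + weight (cutoff δ N) N' * M * b y) := by
      refine intervalIntegral.integral_mono_on hu.1 ?_ ((hIa.const_mul _).add (hIb.const_mul _)) ?_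
      · refine IntervalIntegrable.continuousOn_mul ((hIa.const_mul _).add
          (IntervalIntegrable.const_mul (hIb.mul_continuousOn
            ((hv.ac (N' + 2) s u hs hu.1).const_mul _).continuousOn) _)) ?_
        exact (absolutelyContinuous_exp ((intervalIntegrable_of_Ici hfint.neg hs
          hu0).absolutelyContinuousOnInterval_intervalIntegral (by simp))).continuousOn
      · intro y hy
        have hy0 : 0 ≤ y := hs.trans hy.1
        have hexp : Real.exp (∫ x in s..y, -f x) ≤ 1 := by
          rw [Real.exp_le_one_iff, intervalIntegral.integral_neg, neg_nonpos]
          exact intervalIntegral.integral_nonneg hy.1 fun x hx => hf0 x (hs.trans hx.1)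
        have hA : weight (cutoff δ N) 0 * lam 0 * r * a y = weight δ 0 * lam 0 * r * a y := by
          rw [weight_cutoff_of_le δ (Nat.zero_le N)]
        have hA0 : 0 ≤ weight δ 0 * lam 0 * r * a y :=
          mul_nonneg (mul_nonneg (mul_nonneg hd0.le (hlam 0)) hr) (ha0 y hy0)
        have hw := (weight_pos hcut N').le
        have hB0 : 0 ≤ mu (N' + 1) * (b y * (weight (cutoff δ N) N' * v y (N' + 2))) :=
          mul_nonneg (hmu0 _) (mul_nonneg (hb0 y hy0) (mul_nonneg hw (hv.nonneg _ _)))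
        have hB : mu (N' + 1) * (b y * (weight (cutoff δ N) N' * v y (N' + 2))) ≤
            weight (cutoff δ N) N' * M * b y := by
          have e1 : b y * (weight (cutoff δ N) N' * v y (N' + 2)) ≤
              b y * weight (cutoff δ N) N' :=
            mul_le_mul_of_nonneg_left (mul_le_of_le_one_right hw (hv.le_one y hy0 _)) (hb0 y hy0)
          have e2 := mul_le_mul (hmuM (N' + 1)) e1
            (mul_nonneg (hb0 y hy0) (mul_nonneg hw (hv.nonneg _ _))) hM
          linarith
        rw [hA]
        exact (mul_le_of_le_one_left (add_nonneg hA0 hB0) hexp).trans (add_le_add_right hB _)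
    rw [intervalIntegral.integral_add (hIa.const_mul _) (hIb.const_mul _),
      intervalIntegral.integral_const_mul, intervalIntegral.integral_const_mul] at h3
    simp only [intervalIntegral.integral_neg] at key h3
    have h4 := mul_le_mul_of_nonneg_left h1 (Real.exp_pos (-∫ x in s..u, f x)).le
    linarith
  have hlim : Real.exp (-∫ x in s..u, f x) * wsum δ (v u) N ≤
      W₀ + weight δ 0 * lam 0 * r * (∫ x in s..u, a x) := by
    have ht' := ((tendsto_weight_cutoff δ N).mul_const (M * ∫ x in s..u, b x)).const_add
      (W₀ + weight δ 0 * lam 0 * r * (∫ x in s..u, a x))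
    rw [zero_mul, add_zero] at ht'
    exact ge_of_tendsto ht' (eventually_atTop.2 ⟨N, hstep⟩)
  have hmono : ∀ g : ℝ → ℝ, LocallyIntegrableOn g (Set.Ici 0) → (∀ x, 0 ≤ x → 0 ≤ g x) →
      ∫ x in s..u, g x ≤ ∫ x in s..t, g x := by
    intro g hg hg0
    rw [← intervalIntegral.integral_add_adjacent_intervals (intervalIntegrable_of_Ici hg hs hu0)
      (intervalIntegrable_of_Ici hg hu0 ht)]
    linarith [intervalIntegral.integral_nonneg (μ := volume) hu.2
      fun x hx => hg0 x (hu0.trans hx.1)]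
  have hWA : Real.exp (-∫ x in s..u, f x) * wsum δ (v u) N ≤
      W₀ + weight δ 0 * lam 0 * r * (∫ x in s..t, a x) :=
    hlim.trans (add_le_add_right (mul_le_mul_of_nonneg_left (hmono a ha ha0)
      (mul_nonneg (mul_nonneg hd0.le (hlam 0)) hr)) _)
  have hws : 0 ≤ wsum δ (v u) N :=
    Finset.sum_nonneg fun k _ => mul_nonneg (weight_pos hδ0 k).le (hv.nonneg _ _)
  calc wsum δ (v u) N
      = Real.exp (∫ x in s..u, f x) * (Real.exp (-∫ x in s..u, f x) * wsum δ (v u) N) := by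
        rw [← mul_assoc, ← Real.exp_add, add_neg_cancel, Real.exp_zero, one_mul]
    _ ≤ Real.exp (∫ x in s..t, f x) * (Real.exp (-∫ x in s..u, f x) * wsum δ (v u) N) :=
        mul_le_mul_of_nonneg_right (Real.exp_le_exp.2 (hmono f hfint hf0))
          (mul_nonneg (Real.exp_pos _).le hws)
    _ ≤ _ := mul_le_mul_of_nonneg_left hWA (Real.exp_pos _).le

/-- The weighted `l¹` bound for subsolutions. -/
theorem wsum_le
    (hv : IsSubsolution lam mu a b r v) (hlam : ∀ k, 0 ≤ lam k) (hlamL : ∀ k, lam k ≤ L)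
    (hmu : mu 0 = 0) (hmu0 : ∀ k, 0 ≤ mu k) (hmuM : ∀ k, mu k ≤ M)
    (hδ : ∀ k, 1 ≤ δ k) (hδ2 : ∀ k, δ k ≤ 2) (ha : LocallyIntegrableOn a (Set.Ici 0))
    (hb : LocallyIntegrableOn b (Set.Ici 0)) (ha0 : ∀ t, 0 ≤ t → 0 ≤ a t)
    (hb0 : ∀ t, 0 ≤ t → 0 ≤ b t) {c : ℝ → ℝ} (hc : LocallyIntegrableOn c (Set.Ici 0))
    (hα : ∀ k t, 0 ≤ t → c t ≤ alpha lam mu δ a b k t) {W₀ s t : ℝ} (hs : 0 ≤ s) (hst : s ≤ t)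
    (hW : ∀ N, wsum δ (v s) N ≤ W₀) (N : ℕ) :
    Real.exp (∫ u in s..t, c u) * wsum δ (v t) N ≤
      W₀ + weight δ 0 * lam 0 * r * ∫ u in s..t, Real.exp (∫ x in s..u, c x) * a u := by
  obtain ⟨B, hB⟩ := exists_wsum_bound (t := t) hv hlam hlamL hmu hmu0 hmuM hδ hδ2 ha hb ha0 hb0
    hs hW
  have ht := hs.trans hst
  have hδ0 : ∀ k, 0 < δ k := fun k => by linarith [hδ k]
  have hM : 0 ≤ M := (hmu0 0).trans (hmuM 0)
  have hIa := intervalIntegrable_of_Ici ha hs ht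
  have hIb := intervalIntegrable_of_Ici hb hs ht
  have hE : ContinuousOn (fun u => Real.exp (∫ x in s..u, c x)) (Set.uIcc s t) :=
    (absolutelyContinuous_exp ((intervalIntegrable_of_Ici hc hs
      ht).absolutelyContinuousOnInterval_intervalIntegral (by simp))).continuousOn
  have hterm : ∀ n, IntervalIntegrable (fun u => Real.exp (∫ x in s..u, c x) *
      (mu (n + 1) * (b u * (weight δ n * v u (n + 2))))) volume s t := fun n =>
    ((hIb.mul_continuousOn ((hv.ac (n + 2) s t hs hst).const_mul _).continuousOn).const_mul
      _).continuousOn_mul hE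
  have hnn : ∀ u n, 0 ≤ weight δ n * v u (n + 1) := fun u n =>
    mul_nonneg (weight_pos hδ0 n).le (hv.nonneg _ _)
  have hle : ∀ u n, weight δ n * v u (n + 2) ≤ weight δ (n + 1) * v u (n + 1 + 1) := by
    intro u n
    refine mul_le_mul_of_nonneg_right ?_ (hv.nonneg u _)
    rw [weight_succ]
    exact le_mul_of_one_le_right (weight_pos hδ0 n).le (hδ _)
  have hnn2 : ∀ u n, 0 ≤ weight δ n * v u (n + 2) := fun u n =>
    mul_nonneg (weight_pos hδ0 n).le (hv.nonneg _ _)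
  have hlim : Tendsto (fun n => ∫ u in s..t, Real.exp (∫ x in s..u, c x) *
      (mu (n + 1) * (b u * (weight δ n * v u (n + 2))))) atTop (𝓝 (∫ u in s..t, (0 : ℝ))) := by
    refine intervalIntegral.tendsto_integral_filter_of_dominated_convergence
      (fun u => Real.exp (∫ x in s..u, c x) * (M * B * b u))
      (Eventually.of_forall fun n => (hterm n).aestronglyMeasurable_restrict_uIoc)
      (Eventually.of_forall fun n => Eventually.of_forall fun u hu => ?_)
      ((hIb.const_mul _).continuousOn_mul hE) (Eventually.of_forall fun u hu => ?_)
    · rw [Set.uIoc_of_le hst] at hu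
      have hb' := hb0 u (hs.trans hu.1.le)
      have h1 : weight δ n * v u (n + 2) ≤ B := by
        refine (hle u n).trans (le_trans ?_ (hB u ⟨hu.1.le, hu.2⟩ (n + 1)))
        exact Finset.single_le_sum (f := fun k => weight δ k * v u (k + 1))
          (fun k _ => hnn u k) (Finset.mem_range.2 (Nat.lt_succ_self (n + 1)))
      rw [Real.norm_eq_abs, abs_of_nonneg (mul_nonneg (Real.exp_pos _).le
        (mul_nonneg (hmu0 _) (mul_nonneg hb' (hnn2 u n))))]
      refine mul_le_mul_of_nonneg_left ?_ (Real.exp_pos _).le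
      have e2 := mul_le_mul (hmuM (n + 1)) (mul_le_mul_of_nonneg_left h1 hb')
        (mul_nonneg hb' (hnn2 u n)) hM
      linarith
    · rw [Set.uIoc_of_le hst] at hu
      have hsum : Summable fun k => weight δ k * v u (k + 1) := by
        refine summable_of_sum_range_le (c := B) (hnn u) fun n => ?_
        refine le_trans ?_ (hB u ⟨hu.1.le, hu.2⟩ n)
        exact Finset.sum_le_sum_of_subset_of_nonneg (Finset.range_mono (Nat.le_succ n))
          fun k _ _ => hnn u k
      have h0 : Tendsto (fun n => weight δ n * v u (n + 2)) atTop (𝓝 0) :=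
        squeeze_zero (hnn2 u) (hle u) ((tendsto_add_atTop_iff_nat 1).2 hsum.tendsto_atTop_zero)
      have h1 : Tendsto (fun n => mu (n + 1) * (weight δ n * v u (n + 2))) atTop (𝓝 0) := by
        refine squeeze_zero (fun n => mul_nonneg (hmu0 _) (hnn2 u n))
          (fun n => mul_le_mul_of_nonneg_right (hmuM (n + 1)) (hnn2 u n)) ?_
        simpa using h0.const_mul M
      have h2 := h1.const_mul (Real.exp (∫ x in s..u, c x) * b u)
      rw [mul_zero] at h2
      refine h2.congr fun n => ?_
      ring
  have hstep : ∀ n, N ≤ n → Real.exp (∫ u in s..t, c u) * wsum δ (v t) N ≤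
      W₀ + weight δ 0 * lam 0 * r * (∫ u in s..t, Real.exp (∫ x in s..u, c x) * a u) +
        ∫ u in s..t, Real.exp (∫ x in s..u, c x) *
          (mu (n + 1) * (b u * (weight δ n * v u (n + 2)))) := by
    intro n hn
    have key := wsum_le_of_alpha_ge hv hlam hmu hδ0 ha hb hc ha0 hα hs hst n
    have h1 := mul_le_mul_of_nonneg_left (wsum_mono hδ0 (hv.nonneg t) hn)
      (Real.exp_pos (∫ u in s..t, c u)).le
    simp only [mul_add] at key
    rw [intervalIntegral.integral_add ((hIa.const_mul _).continuousOn_mul hE) (hterm n)] at key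
    have h2 : ∫ u in s..t, Real.exp (∫ x in s..u, c x) * (weight δ 0 * lam 0 * r * a u) =
        weight δ 0 * lam 0 * r * ∫ u in s..t, Real.exp (∫ x in s..u, c x) * a u := by
      rw [← intervalIntegral.integral_const_mul]
      exact intervalIntegral.integral_congr fun u _ => by ring
    rw [h2] at key
    linarith [hW n]
  have hfin := hlim.const_add
    (W₀ + weight δ 0 * lam 0 * r * (∫ u in s..t, Real.exp (∫ x in s..u, c x) * a u))
  rw [intervalIntegral.integral_zero, add_zero] at hfin
  exact ge_of_tendsto hfin (eventually_atTop.2 ⟨N, hstep⟩)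

end

/-- A solution of the forward Kolmogorov system in the integrated sense. -/
structure IsForwardSolution (lam mu : ℕ → ℝ) (a b : ℝ → ℝ) (x : ℝ → ℕ → ℝ) : Prop where
  continuousOn : ∀ n, ContinuousOn (fun t => x t n) (Set.Ici 0)
  forward : ∀ t, 0 ≤ t → ∀ n,
    x t n = x 0 n + ∫ u in (0 : ℝ)..t, forwardRHS lam mu a b u (x u) n

/-- The flux from `{0, …, n}` to `{n + 1, …}`. -/
def flux (lam mu : ℕ → ℝ) (a b : ℝ → ℝ) (x : ℝ → ℕ → ℝ) (n : ℕ) (u : ℝ) : ℝ :=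
  lam n * a u * x u n - mu (n + 1) * b u * x u (n + 1)

/-- The tail `∑_{j ≥ n} x_j` of a vector with sum `κ`. -/
def tail (κ : ℝ) (x : ℕ → ℝ) (n : ℕ) : ℝ := κ - ∑ j ∈ Finset.range n, x j

theorem tail_sub_tail_succ (κ : ℝ) (x : ℕ → ℝ) (n : ℕ) : tail κ x n - tail κ x (n + 1) = x n := by
  rw [tail, tail, Finset.sum_range_succ]
  ring

/-- The excess of the absolute value of the tail over the level `η`. -/
noncomputable def excess (η κ : ℝ) (x : ℕ → ℝ) (n : ℕ) : ℝ := max (|tail κ x n| - η) 0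

theorem absolutelyContinuous_congr {f g : ℝ → ℝ} {s t : ℝ}
    (hf : AbsolutelyContinuousOnInterval f s t) (h : Set.EqOn f g (Set.uIcc s t)) :
    AbsolutelyContinuousOnInterval g s t := by
  rw [absolutelyContinuousOnInterval_iff] at hf ⊢
  intro e he
  obtain ⟨d, hd, H⟩ := hf e he
  refine ⟨d, hd, fun E hE hlen => lt_of_eq_of_lt ?_ (H E hE hlen)⟩
  refine Finset.sum_congr rfl fun i hi => ?_
  rw [h (hE.1 i hi).1, h (hE.1 i hi).2]

section

variable {lam mu : ℕ → ℝ} {a b : ℝ → ℝ} {x : ℝ → ℕ → ℝ}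

theorem IsForwardSolution.intervalIntegrable (hx : IsForwardSolution lam mu a b x)
    (ha : LocallyIntegrableOn a (Set.Ici 0)) (hb : LocallyIntegrableOn b (Set.Ici 0)) {t : ℝ}
    (ht : 0 ≤ t) (n : ℕ) :
    IntervalIntegrable (fun u => a u * x u n) volume 0 t ∧
      IntervalIntegrable (fun u => b u * x u n) volume 0 t := by
  have hc : ContinuousOn (fun u => x u n) (Set.uIcc 0 t) :=
    (hx.continuousOn n).mono fun u hu => (le_min le_rfl ht).trans hu.1
  exact ⟨(intervalIntegrable_of_Ici ha le_rfl ht).mul_continuousOn hc,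
    (intervalIntegrable_of_Ici hb le_rfl ht).mul_continuousOn hc⟩

theorem IsForwardSolution.intervalIntegrable_flux (hx : IsForwardSolution lam mu a b x)
    (ha : LocallyIntegrableOn a (Set.Ici 0)) (hb : LocallyIntegrableOn b (Set.Ici 0)) {t : ℝ}
    (ht : 0 ≤ t) (n : ℕ) : IntervalIntegrable (flux lam mu a b x n) volume 0 t := by
  have h1 := (hx.intervalIntegrable ha hb ht n).1.const_mul (lam n)
  have h2 := (hx.intervalIntegrable ha hb ht (n + 1)).2.const_mul (mu (n + 1))
  refine (h1.sub h2).congr fun u _ => ?_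
  simp only [flux]
  ring

theorem forwardRHS_zero_eq (hmu : mu 0 = 0) (u : ℝ) :
    forwardRHS lam mu a b u (x u) 0 = -flux lam mu a b x 0 u := by
  simp only [forwardRHS, flux, hmu]
  ring

theorem forwardRHS_succ_eq (u : ℝ) (n : ℕ) :
    forwardRHS lam mu a b u (x u) (n + 1) =
      flux lam mu a b x n u - flux lam mu a b x (n + 1) u := by
  simp only [forwardRHS, flux]
  ring

theorem IsForwardSolution.intervalIntegrable_forwardRHS (hx : IsForwardSolution lam mu a b x)
    (hmu : mu 0 = 0) (ha : LocallyIntegrableOn a (Set.Ici 0))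
    (hb : LocallyIntegrableOn b (Set.Ici 0)) {t : ℝ} (ht : 0 ≤ t) (n : ℕ) :
    IntervalIntegrable (fun u => forwardRHS lam mu a b u (x u) n) volume 0 t := by
  cases n with
  | zero =>
    simp only [forwardRHS_zero_eq hmu]
    exact (hx.intervalIntegrable_flux ha hb ht 0).neg
  | succ n =>
    simp only [forwardRHS_succ_eq]
    exact (hx.intervalIntegrable_flux ha hb ht n).sub (hx.intervalIntegrable_flux ha hb ht (n + 1))

theorem IsForwardSolution.tail_eq (hx : IsForwardSolution lam mu a b x)
    (hmu : mu 0 = 0) (ha : LocallyIntegrableOn a (Set.Ici 0))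
    (hb : LocallyIntegrableOn b (Set.Ici 0)) (κ : ℝ) {t : ℝ} (ht : 0 ≤ t) (n : ℕ) :
    tail κ (x t) (n + 1) = tail κ (x 0) (n + 1) + ∫ u in (0 : ℝ)..t, flux lam mu a b x n u := by
  induction n with
  | zero =>
    have h := hx.forward t ht 0
    simp only [forwardRHS_zero_eq hmu, intervalIntegral.integral_neg] at h
    simp only [tail, zero_add, Finset.sum_range_one]
    linarith
  | succ n ih =>
    have h := hx.forward t ht (n + 1)
    simp only [forwardRHS_succ_eq] at h
    rw [intervalIntegral.integral_sub (hx.intervalIntegrable_flux ha hb ht n)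
      (hx.intervalIntegrable_flux ha hb ht (n + 1))] at h
    have h1 := tail_sub_tail_succ κ (x t) (n + 1)
    have h2 := tail_sub_tail_succ κ (x 0) (n + 1)
    linarith

theorem IsForwardSolution.absolutelyContinuous_excess (hx : IsForwardSolution lam mu a b x)
    (hmu : mu 0 = 0) (ha : LocallyIntegrableOn a (Set.Ici 0))
    (hb : LocallyIntegrableOn b (Set.Ici 0)) (η κ : ℝ) (n : ℕ) {s t : ℝ} (hs : 0 ≤ s)
    (hst : s ≤ t) : AbsolutelyContinuousOnInterval (fun u => excess η κ (x u) n) s t := by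
  have hlip : LipschitzOnWith 1 (fun y : ℝ => max (|y| - η) 0) Set.univ := by
    refine LipschitzOnWith.of_dist_le_mul fun y _ y' _ => ?_
    rw [Real.dist_eq, Real.dist_eq, NNReal.coe_one, one_mul]
    refine (abs_max_sub_max_le_abs _ _ _).trans ?_
    rw [sub_sub_sub_cancel_right]
    exact abs_abs_sub_abs_le _ _
  suffices h : AbsolutelyContinuousOnInterval (fun u => tail κ (x u) n) s t by
    have h' := absolutelyContinuous_comp hlip h (Set.mapsTo_univ _ _)
    simpa only [excess] using h'
  cases n with
  | zero =>
    simp only [tail, Finset.range_zero, Finset.sum_empty, sub_zero]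
    exact absolutelyContinuous_const κ s t
  | succ n =>
    have ht := hs.trans hst
    have h1 := (hx.intervalIntegrable_flux ha hb ht
      n).absolutelyContinuousOnInterval_intervalIntegral (c := 0) (by simp)
    have h2 := (absolutelyContinuous_const (tail κ (x 0) (n + 1)) 0 t).fun_add h1
    refine (absolutelyContinuous_congr h2 fun u hu => ?_).mono ?_
    · rw [Set.uIcc_of_le ht] at hu
      exact (hx.tail_eq hmu ha hb κ hu.1 n).symm
    · rw [Set.uIcc_of_le ht, Set.uIcc_of_le hst]
      exact Set.Icc_subset_Icc_left hs

theorem IsForwardSolution.ae_hasDerivAt_tail (hx : IsForwardSolution lam mu a b x)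
    (hmu : mu 0 = 0) (ha : LocallyIntegrableOn a (Set.Ici 0))
    (hb : LocallyIntegrableOn b (Set.Ici 0)) (κ : ℝ) (n : ℕ) :
    ∀ᵐ u : ℝ, 0 ≤ u →
      HasDerivAt (fun y => tail κ (x y) (n + 1)) (flux lam mu a b x n u) u := by
  have hae : ∀ᵐ u : ℝ, ∀ N : ℕ, u ∈ Set.uIcc 0 (N : ℝ) → ∀ c ∈ Set.uIcc 0 (N : ℝ),
      HasDerivAt (fun y => ∫ w in c..y, flux lam mu a b x n w) (flux lam mu a b x n u) u :=
    ae_all_iff.2 fun N =>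
      (hx.intervalIntegrable_flux ha hb N.cast_nonneg n).ae_hasDerivAt_integral
  have hne : ∀ᵐ u : ℝ, u ≠ 0 := by simp [ae_iff, measure_singleton]
  filter_upwards [hae, hne] with u hu hu1 hu0
  have hpos : 0 < u := lt_of_le_of_ne hu0 (Ne.symm hu1)
  obtain ⟨N, hN⟩ := exists_nat_ge u
  refine ((hu N ?_ 0 (by simp)).const_add (tail κ (x 0) (n + 1))).congr_of_eventuallyEq ?_
  · rw [Set.uIcc_of_le N.cast_nonneg]
    exact ⟨hu0, hN⟩
  · filter_upwards [Ioi_mem_nhds hpos] with y hy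
    exact hx.tail_eq hmu ha hb κ (le_of_lt hy) n

theorem deriv_excess_le (hlam : ∀ k, 0 ≤ lam k) (hmu0 : ∀ k, 0 ≤ mu k) {η κ u : ℝ} {n : ℕ}
    (hη : 0 ≤ η) (hau : 0 ≤ a u) (hbu : 0 ≤ b u)
    (hder : HasDerivAt (fun y => tail κ (x y) (n + 1)) (flux lam mu a b x n u) u) :
    deriv (fun y => excess η κ (x y) (n + 1)) u ≤
      lam n * a u * (excess η κ (x u) n - excess η κ (x u) (n + 1)) -
        mu (n + 1) * b u * (excess η κ (x u) (n + 1) - excess η κ (x u) (n + 2)) := by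
  have hflux : flux lam mu a b x n u =
      lam n * a u * (tail κ (x u) n - tail κ (x u) (n + 1)) -
        mu (n + 1) * b u * (tail κ (x u) (n + 1) - tail κ (x u) (n + 2)) := by
    rw [tail_sub_tail_succ, tail_sub_tail_succ, flux]
  have hA : 0 ≤ lam n * a u := mul_nonneg (hlam n) hau
  have hB : 0 ≤ mu (n + 1) * b u := mul_nonneg (hmu0 _) hbu
  have hex : ∀ k, |tail κ (x u) k| ≤ excess η κ (x u) k + η := fun k =>
    sub_le_iff_le_add.1 (le_max_left _ _)
  have hex0 : ∀ k, 0 ≤ excess η κ (x u) k := fun k => le_max_right _ _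
  by_cases hlev : |tail κ (x u) (n + 1)| ≤ η
  · have hz : excess η κ (x u) (n + 1) = 0 := max_eq_right (by linarith)
    have hmin : IsLocalMin (fun y => excess η κ (x y) (n + 1)) u :=
      Eventually.of_forall fun y => by
        change excess η κ (x u) (n + 1) ≤ _
        rw [hz]
        exact le_max_right _ _
    rw [hmin.deriv_eq_zero, hz]
    have e1 := mul_nonneg hA (hex0 n)
    have e2 := mul_nonneg hB (hex0 (n + 2))
    linarith
  · rw [not_le] at hlev
    have hz : excess η κ (x u) (n + 1) = |tail κ (x u) (n + 1)| - η := max_eq_left (by linarith)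
    have hev : ∀ᶠ y in 𝓝 u, η < |tail κ (x y) (n + 1)| :=
      hder.continuousAt.abs.eventually (lt_mem_nhds hlev)
    rcases lt_trichotomy (tail κ (x u) (n + 1)) 0 with hs | hs | hs
    · have hd : HasDerivAt (fun y => excess η κ (x y) (n + 1)) (-flux lam mu a b x n u) u := by
        refine (hder.neg.sub_const η).congr_of_eventuallyEq ?_
        filter_upwards [hev, hder.continuousAt.eventually (gt_mem_nhds hs)] with y hy hy'
        simp only [excess, Pi.neg_apply]
        rw [max_eq_left (by linarith), abs_of_neg hy']
      rw [hd.deriv, hflux, hz, abs_of_neg hs]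
      have e1 := mul_le_mul_of_nonneg_left ((neg_le_abs _).trans (hex n)) hA
      have e2 := mul_le_mul_of_nonneg_left ((neg_le_abs _).trans (hex (n + 2))) hB
      linarith
    · rw [hs, abs_zero] at hlev
      linarith
    · have hd : HasDerivAt (fun y => excess η κ (x y) (n + 1)) (flux lam mu a b x n u) u := by
        refine (hder.sub_const η).congr_of_eventuallyEq ?_
        filter_upwards [hev, hder.continuousAt.eventually (lt_mem_nhds hs)] with y hy hy'
        simp only [excess]
        rw [max_eq_left (by linarith), abs_of_pos hy']
      rw [hd.deriv, hflux, hz, abs_of_pos hs]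
      have e1 := mul_le_mul_of_nonneg_left ((le_abs_self _).trans (hex n)) hA
      have e2 := mul_le_mul_of_nonneg_left ((le_abs_self _).trans (hex (n + 2))) hB
      linarith

/-- The excess of the tails over a level is a subsolution. -/
theorem IsForwardSolution.isSubsolution_excess (hx : IsForwardSolution lam mu a b x)
    (hmu : mu 0 = 0) (hlam : ∀ k, 0 ≤ lam k) (hmu0 : ∀ k, 0 ≤ mu k)
    (ha : LocallyIntegrableOn a (Set.Ici 0)) (hb : LocallyIntegrableOn b (Set.Ici 0))
    (ha0 : ∀ t, 0 ≤ t → 0 ≤ a t) (hb0 : ∀ t, 0 ≤ t → 0 ≤ b t) {η κ : ℝ} (hη : 0 ≤ η)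
    (hone : ∀ u, 0 ≤ u → ∀ n, |tail κ (x u) n| ≤ 1) :
    IsSubsolution lam mu a b |κ| (fun u => excess η κ (x u)) where
  nonneg u n := le_max_right _ _
  le_one u hu n := max_le (by linarith [hone u hu n]) zero_le_one
  zero_le u _ := by
    simp only [excess, tail, Finset.range_zero, Finset.sum_empty, sub_zero]
    exact max_le (by linarith) (abs_nonneg κ)
  ac n s t hs hst := hx.absolutelyContinuous_excess hmu ha hb η κ n hs hst
  deriv_le n := by
    filter_upwards [hx.ae_hasDerivAt_tail hmu ha hb κ n] with u hu hu0
    exact deriv_excess_le hlam hmu0 hη (ha0 u hu0) (hb0 u hu0) (hu hu0)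

end

section

variable {lam mu : ℕ → ℝ} {a b : ℝ → ℝ} {p p₁ p₂ : ℝ → ℕ → ℝ}

theorem IsStateProb.isForwardSolution (h : IsStateProb lam mu a b p) :
    IsForwardSolution lam mu a b p := ⟨h.continuousOn, h.forward⟩

theorem IsForwardSolution.sub (hmu : mu 0 = 0) (ha : LocallyIntegrableOn a (Set.Ici 0))
    (hb : LocallyIntegrableOn b (Set.Ici 0)) (h₁ : IsForwardSolution lam mu a b p₁)
    (h₂ : IsForwardSolution lam mu a b p₂) :
    IsForwardSolution lam mu a b (fun t n => p₁ t n - p₂ t n) where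
  continuousOn n := (h₁.continuousOn n).sub (h₂.continuousOn n)
  forward t ht n := by
    have e : ∀ u, forwardRHS lam mu a b u (fun n => p₁ u n - p₂ u n) n =
        forwardRHS lam mu a b u (p₁ u) n - forwardRHS lam mu a b u (p₂ u) n := by
      intro u
      cases n <;> simp only [forwardRHS] <;> ring
    simp only [e]
    rw [intervalIntegral.integral_sub (h₁.intervalIntegrable_forwardRHS hmu ha hb ht n)
      (h₂.intervalIntegrable_forwardRHS hmu ha hb ht n), h₁.forward t ht n, h₂.forward t ht n]
    ring

theorem IsStateProb.tail_mem (h : IsStateProb lam mu a b p) {u : ℝ} (hu : 0 ≤ u) (n : ℕ) :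
    0 ≤ tail 1 (p u) n ∧ tail 1 (p u) n ≤ 1 := by
  have h1 := sum_le_hasSum (Finset.range n) (fun i _ => h.nonneg u hu i) (h.hasSum_one u hu)
  have h2 := Finset.sum_nonneg (s := Finset.range n) (fun i _ => h.nonneg u hu i)
  unfold tail
  constructor <;> linarith

theorem tail_sub (x y : ℕ → ℝ) (n : ℕ) :
    tail 0 (fun n => x n - y n) n = tail 1 x n - tail 1 y n := by
  simp only [tail, Finset.sum_sub_distrib]
  ring

theorem IsStateProb.isSubsolution_sub (h₁ : IsStateProb lam mu a b p₁)
    (h₂ : IsStateProb lam mu a b p₂) (hmu : mu 0 = 0) (hlam : ∀ k, 0 ≤ lam k)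
    (hmu0 : ∀ k, 0 ≤ mu k) (ha : LocallyIntegrableOn a (Set.Ici 0))
    (hb : LocallyIntegrableOn b (Set.Ici 0)) (ha0 : ∀ t, 0 ≤ t → 0 ≤ a t)
    (hb0 : ∀ t, 0 ≤ t → 0 ≤ b t) {η : ℝ} (hη : 0 ≤ η) :
    IsSubsolution lam mu a b 0 (fun u => excess η 0 (fun n => p₁ u n - p₂ u n)) := by
  have h := (h₁.isForwardSolution.sub hmu ha hb h₂.isForwardSolution).isSubsolution_excess (κ := 0)
    hmu hlam hmu0 ha hb ha0 hb0 hη fun u hu n => by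
      rw [tail_sub, abs_le]
      have e1 := h₁.tail_mem hu n
      have e2 := h₂.tail_mem hu n
      constructor <;> linarith
  rwa [abs_zero] at h

theorem IsStateProb.isSubsolution (h : IsStateProb lam mu a b p) (hmu : mu 0 = 0)
    (hlam : ∀ k, 0 ≤ lam k) (hmu0 : ∀ k, 0 ≤ mu k) (ha : LocallyIntegrableOn a (Set.Ici 0))
    (hb : LocallyIntegrableOn b (Set.Ici 0)) (ha0 : ∀ t, 0 ≤ t → 0 ≤ a t)
    (hb0 : ∀ t, 0 ≤ t → 0 ≤ b t) {η : ℝ} (hη : 0 ≤ η) :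
    IsSubsolution lam mu a b 1 (fun u => excess η 1 (p u)) := by
  have h := h.isForwardSolution.isSubsolution_excess (κ := 1)
    hmu hlam hmu0 ha hb ha0 hb0 hη fun u hu n => by
      rw [abs_of_nonneg (h.tail_mem hu n).1]
      exact (h.tail_mem hu n).2
  rwa [abs_one] at h

end

/-- The primitive of a function that is eventually bounded by `e` grows at most at rate `e`. -/
theorem exists_integral_le_of_eventually_le {h : ℝ → ℝ} (hint : ∀ s t, 0 ≤ s → 0 ≤ t →
      IntervalIntegrable h volume s t) (h0 : ∀ u, 0 ≤ u → 0 ≤ h u) {e : ℝ} (he : 0 ≤ e)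
    (hev : ∀ᶠ u in atTop, h u ≤ e) :
    ∃ C, ∀ s t, 0 ≤ s → s ≤ t → ∫ u in s..t, h u ≤ e * (t - s) + C := by
  obtain ⟨M₀, hM₀⟩ := eventually_atTop.1 hev
  set M := max M₀ 0 with hMdef
  have hM0 : 0 ≤ M := le_max_right _ _
  have hM : ∀ u, M ≤ u → h u ≤ e := fun u hu => hM₀ u ((le_max_left _ _).trans hu)
  have hnn : ∀ s t, 0 ≤ s → s ≤ t → 0 ≤ ∫ u in s..t, h u := fun s t hs hst =>
    intervalIntegral.integral_nonneg hst fun u hu => h0 u (hs.trans hu.1)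
  have hfar : ∀ s t, M ≤ s → s ≤ t → ∫ u in s..t, h u ≤ e * (t - s) := by
    intro s t hs hst
    have h1 := intervalIntegral.integral_mono_on (μ := volume) hst
      (hint s t (hM0.trans hs) (hM0.trans (hs.trans hst)))
      (intervalIntegrable_const (c := e)) fun u hu => hM u (hs.trans hu.1)
    rw [intervalIntegral.integral_const, smul_eq_mul] at h1
    linarith
  have hnear : ∀ s t, 0 ≤ s → s ≤ t → t ≤ M → ∫ u in s..t, h u ≤ ∫ u in (0 : ℝ)..M, h u := by
    intro s t hs hst ht
    have ht0 := hs.trans hst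
    rw [← intervalIntegral.integral_add_adjacent_intervals (hint 0 s le_rfl hs) (hint s M hs hM0),
      ← intervalIntegral.integral_add_adjacent_intervals (hint s t hs ht0) (hint t M ht0 hM0)]
    linarith [hnn 0 s le_rfl hs, hnn t M ht0 ht]
  refine ⟨∫ u in (0 : ℝ)..M, h u, fun s t hs hst => ?_⟩
  rcases le_total t M with ht | ht
  · linarith [hnear s t hs hst ht, mul_nonneg he (sub_nonneg.2 hst)]
  · rcases le_total M s with hs' | hs'
    · linarith [hfar s t hs' hst, hnn 0 M le_rfl hM0]
    · rw [← intervalIntegral.integral_add_adjacent_intervals (hint s M hs hM0)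
        (hint M t hM0 (hM0.trans ht))]
      have h1 := hnear s M hs hs' le_rfl
      have h2 := hfar M t le_rfl ht
      have h3 := mul_le_mul_of_nonneg_left (sub_le_sub_left hs' t) he
      linarith

/-- A function that is periodic on `[0, ∞)` agrees there with a periodic function on `ℝ`. -/
theorem exists_periodic_extension {f : ℝ → ℝ} {T : ℝ} (hT : 0 < T)
    (hf : ∀ t, 0 ≤ t → f (t + T) = f t) :
    ∃ g : ℝ → ℝ, Function.Periodic g T ∧ ∀ t, 0 ≤ t → g t = f t := by
  have hn : ∀ (n : ℕ) (t : ℝ), 0 ≤ t → f (t + n * T) = f t := by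
    intro n t ht
    induction n with
    | zero => simp
    | succ n ih =>
      rw [← ih, ← hf (t + n * T) (by positivity)]
      push_cast
      ring_nf
  refine ⟨fun t => f (toIcoMod hT 0 t), fun t => by simp, fun t ht => ?_⟩
  have h1 := toIcoMod_add_toIcoDiv_zsmul hT 0 t
  have h2 := toIcoMod_mem_Ico hT 0 t
  rw [zero_add] at h2
  have h3 : 0 ≤ toIcoDiv hT 0 t := by
    by_contra hneg
    have h4 : ((toIcoDiv hT 0 t : ℤ) : ℝ) ≤ -1 := by
      exact_mod_cast Int.le_sub_one_of_lt (not_le.1 hneg)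
    rw [zsmul_eq_mul] at h1
    nlinarith [h2.2]
  obtain ⟨n, hn'⟩ := Int.eq_ofNat_of_zero_le h3
  rw [hn', zsmul_eq_mul] at h1
  have h5 := hn n (toIcoMod hT 0 t) h2.1
  refine h5.symm.trans (congrArg f ?_)
  exact_mod_cast h1

/-- The mean value over long intervals of an asymptotically periodic function is the mean value of
the periodic part over one period. -/
theorem IsAsympPeriodic.exists_abs_integral_sub_le {f f₁ : ℝ → ℝ} {T : ℝ}
    (h : IsAsympPeriodic f f₁ T) {e : ℝ} (he : 0 < e) :
    ∃ C, ∀ s t, 0 ≤ s → s ≤ t →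
      |(∫ u in s..t, f u) - periodMean f₁ T * (t - s)| ≤ e * (t - s) + C := by
  obtain ⟨g, hg, hgf⟩ := exists_periodic_extension h.period_pos h.periodic
  have hT := h.period_pos
  have hgint : ∀ s t, IntervalIntegrable g volume s t := by
    refine hg.intervalIntegrable₀ hT.ne' (h.integrable.congr fun u hu => ?_)
    rw [Set.uIoc_of_le hT.le] at hu
    exact (hgf u hu.1.le).symm
  have hfint : ∀ s t, 0 ≤ s → 0 ≤ t → IntervalIntegrable f volume s t := fun s t hs ht =>
    intervalIntegrable_of_Ici h.locallyIntegrable hs ht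
  have hmean : periodMean f₁ T * T = ∫ u in (0 : ℝ)..T, g u := by
    have e1 : ∫ u in (0 : ℝ)..T, g u = ∫ u in (0 : ℝ)..T, f₁ u :=
      intervalIntegral.integral_congr fun u hu => by
        rw [Set.uIcc_of_le hT.le] at hu
        exact hgf u hu.1
    rw [e1, periodMean]
    field_simp
  set H : ℝ → ℝ := fun t => (∫ u in (0 : ℝ)..t, g u) - periodMean f₁ T * t with hH
  have hHper : Function.Periodic H T := by
    intro t
    have e1 := hg.intervalIntegral_add_eq_add 0 t hgint
    simp only [zero_add] at e1
    simp only [hH]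
    rw [e1, mul_add, hmean]
    ring
  have hHcont : Continuous H :=
    (intervalIntegral.continuous_primitive hgint 0).sub (continuous_const.mul continuous_id)
  obtain ⟨B, hB⟩ := (hHper.isBounded_of_continuous hT.ne' hHcont).exists_norm_le
  have hBt : ∀ t, |H t| ≤ B := fun t => hB (H t) ⟨t, rfl⟩
  obtain ⟨C, hC⟩ := exists_integral_le_of_eventually_le (h := fun u => |f u - g u|)
    (fun s t hs ht => ((hfint s t hs ht).sub (hgint s t)).abs) (fun u _ => abs_nonneg _) he.le (by
      have e1 := h.tendsto.abs
      rw [abs_zero] at e1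
      filter_upwards [e1.eventually (gt_mem_nhds he), eventually_ge_atTop 0] with u hu hu0
      rw [hgf u hu0]
      exact hu.le)
  refine ⟨C + 2 * B, fun s t hs hst => ?_⟩
  have ht := hs.trans hst
  have e1 : ∫ u in s..t, f u = (∫ u in s..t, (f u - g u)) + ∫ u in s..t, g u := by
    rw [intervalIntegral.integral_sub (hfint s t hs ht) (hgint s t)]
    ring
  have e2 : (∫ u in s..t, g u) - periodMean f₁ T * (t - s) = H t - H s := by
    simp only [hH]
    rw [← intervalIntegral.integral_interval_sub_left (hgint 0 t) (hgint 0 s)]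
    ring
  have e3 := (intervalIntegral.abs_integral_le_integral_abs (μ := volume)
    (f := fun u => f u - g u) hst).trans (hC s t hs hst)
  rw [e1, add_sub_assoc, e2]
  have e4 := abs_add_le (∫ u in s..t, (f u - g u)) (H t - H s)
  have e5 := abs_sub (H t) (H s)
  linarith [hBt t, hBt s]

section

variable {S : ℕ} {l m ε : ℝ}

theorem discLam_nonneg (S : ℕ) (hl : 0 ≤ l) (k : ℕ) : 0 ≤ discLam S l k := by
  unfold discLam
  split_ifs with h
  · exact hl
  · have : (S : ℝ) ≤ k := by exact_mod_cast not_lt.1 h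
    exact div_nonneg hl (by linarith)

theorem discLam_le (S : ℕ) (hl : 0 ≤ l) (k : ℕ) : discLam S l k ≤ l := by
  unfold discLam
  split_ifs with h
  · exact le_rfl
  · have : (S : ℝ) ≤ k := by exact_mod_cast not_lt.1 h
    exact div_le_self hl (by linarith)

theorem discMu_zero (S : ℕ) (m : ℝ) : discMu S m 0 = 0 := by simp [discMu]

theorem discMu_nonneg (S : ℕ) (hm : 0 ≤ m) (k : ℕ) : 0 ≤ discMu S m k := by
  unfold discMu
  split_ifs <;> positivity

theorem discMu_le (S : ℕ) (hm : 0 ≤ m) (k : ℕ) : discMu S m k ≤ S * m := by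
  unfold discMu
  split_ifs with h
  · exact mul_le_mul_of_nonneg_right (by exact_mod_cast h) hm
  · exact le_rfl

theorem one_le_discDelta (S : ℕ) (hε : 0 ≤ ε) (k : ℕ) : 1 ≤ discDelta S ε k := by
  unfold discDelta
  split_ifs <;> linarith

theorem discDelta_le_two (S : ℕ) (hε : ε ≤ 1) (k : ℕ) : discDelta S ε k ≤ 2 := by
  unfold discDelta
  split_ifs <;> linarith

theorem rateConst_pos (hS : 1 ≤ S) (hε : 0 < ε) : 0 < rateConst S ε := by
  have : (0 : ℝ) < S := by exact_mod_cast hS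
  exact lt_min one_pos (by positivity)

theorem rateConst_eq (hε : 0 < ε) (h : ((S : ℝ) - 1) * ε ≤ 1) :
    rateConst S ε = S * ε / (1 + ε) := by
  refine min_eq_right ?_
  rw [div_le_one (by linarith)]
  linarith

/-- The coefficient of the birth intensities in `α_k - rate` is nonnegative for `k ≥ S`. -/
theorem discouragement_coeff_nonneg (hS : 1 ≤ S) (hε : 0 < ε) {n : ℝ} (hn : 1 ≤ n) :
    0 ≤ 1 / n - (1 + ε) / (n + 1) + rateConst S ε * ε := by
  have hS' : (1 : ℝ) ≤ S := by exact_mod_cast hS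
  have hκ : ε / (1 + ε) ≤ rateConst S ε := by
    refine le_min ?_ ?_
    · rw [div_le_one (by linarith)]
      linarith
    · exact div_le_div_of_nonneg_right (by nlinarith) (by linarith)
  have h1 := mul_le_mul_of_nonneg_right hκ hε.le
  have h2 : 1 / n - (1 + ε) / (n + 1) + ε / (1 + ε) * ε =
      (1 + ε - n * ε + (n * ε) ^ 2) / (n * (n + 1) * (1 + ε)) := by
    have : n ≠ 0 := by linarith
    have : n + 1 ≠ 0 := by linarith
    have : 1 + ε ≠ 0 := by linarith
    field_simp
    ring
  have h3 : 0 ≤ (1 + ε - n * ε + (n * ε) ^ 2) / (n * (n + 1) * (1 + ε)) :=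
    div_nonneg (by nlinarith [sq_nonneg (n * ε - 1 / 2)]) (by positivity)
  linarith

theorem rate_le_alpha (hS : 1 ≤ S) (hl : 0 < l) (hm : 0 < m) (hε₀ : 0 < ε) (hε₁ : ε < 1)
    {a b : ℝ → ℝ} {t : ℝ} (hat : 0 ≤ a t) (hbt : 0 ≤ b t) (k : ℕ) :
    rate S l m ε a b t ≤ alpha (discLam S l) (discMu S m) (discDelta S ε) a b k t := by
  have hκ := rateConst_pos hS hε₀
  have hκ1 : rateConst S ε ≤ 1 := min_le_left _ _
  have hla : 0 ≤ l * a t := mul_nonneg hl.le hat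
  have hmb : 0 ≤ m * b t := mul_nonneg hm.le hbt
  have hrate : rate S l m ε a b t ≤ m * b t := by
    unfold rate
    have h1 := mul_le_of_le_one_left hmb hκ1
    have h2 := mul_nonneg hκ.le (mul_nonneg hε₀.le hla)
    linarith
  rcases lt_or_ge (k + 1) S with h | h
  · refine hrate.trans (le_of_eq ?_)
    simp only [alpha, discLam, discMu, discDelta, if_pos h, if_pos (Nat.lt_of_succ_lt h),
      if_pos h.le, if_pos (Nat.lt_of_succ_lt h).le]
    push_cast
    ring
  rcases h.eq_or_lt with h | h
  · refine hrate.trans ?_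
    subst h
    simp only [alpha, discLam, discMu, discDelta, lt_irrefl, if_false, le_refl, if_true,
      if_pos (Nat.lt_succ_self k), if_pos (Nat.le_succ k), sub_self, zero_add, inv_one, one_mul]
    push_cast
    have := mul_nonneg (sub_nonneg.2 hε₁.le) hla
    linarith
  · have hk : ¬ k < S := by omega
    have hk1 : ¬ k + 1 < S := by omega
    have hk2 : ¬ k + 1 ≤ S := by omega
    have hSk : (S : ℝ) ≤ k := by exact_mod_cast not_lt.1 hk
    have hmuk : discMu S m k = S * m := by
      unfold discMu
      split_ifs with h'
      · rw [le_antisymm h' (not_lt.1 hk)]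
      · rfl
    have hmuk1 : discMu S m (k + 1) = S * m := if_neg hk2
    have hcoef := mul_nonneg (discouragement_coeff_nonneg (S := S) hS hε₀
      (n := (k : ℝ) - S + 2) (by linarith)) hla
    have hκ2 : rateConst S ε * (m * b t) ≤ S * ε / (1 + ε) * (m * b t) :=
      mul_le_mul_of_nonneg_right (min_le_right _ _) hmb
    have hδ : S * m * b t - (1 + ε)⁻¹ * (S * m * b t) = S * ε / (1 + ε) * (m * b t) := by
      have : 1 + ε ≠ 0 := by linarith
      field_simp
      ring
    have hn : ((k + 1 : ℕ) : ℝ) - S + 2 = k - S + 2 + 1 := by push_cast; ring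
    have hlam : l / ((k : ℝ) - S + 2) * a t - (1 + ε) * (l / ((k : ℝ) - S + 2 + 1) * a t) =
        (1 / ((k : ℝ) - S + 2) - (1 + ε) / ((k : ℝ) - S + 2 + 1)) * (l * a t) := by
      ring
    simp only [rate, alpha, hmuk, hmuk1, discLam, discDelta, if_neg hk, if_neg hk1, hn]
    linarith

theorem locallyIntegrableOn_rate {a b : ℝ → ℝ} (ha : LocallyIntegrableOn a (Set.Ici 0))
    (hb : LocallyIntegrableOn b (Set.Ici 0)) (S : ℕ) (l m ε : ℝ) :
    LocallyIntegrableOn (rate S l m ε a b) (Set.Ici 0) := by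
  have h1 : LocallyIntegrableOn (fun u => m * b u) (Set.Ici 0) := hb.smul m
  have h2 : LocallyIntegrableOn (fun u => l * a u) (Set.Ici 0) := ha.smul l
  have h3 : LocallyIntegrableOn (fun u => ε * (l * a u)) (Set.Ici 0) := h2.smul ε
  exact (h1.sub h3).smul (rateConst S ε)

/-- The rate function decreases exponentials of its primitive at any rate below its mean value. -/
theorem exists_exp_rate_le (hS : 1 ≤ S) (hl : 0 < l) (hm : 0 < m) (hε : 0 < ε)
    {a a₁ b b₁ : ℝ → ℝ} {T₁ T₂ : ℝ} (ha : IsAsympPeriodic a a₁ T₁) (hb : IsAsympPeriodic b b₁ T₂)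
    {η : ℝ} (hη : η < rateConst S ε * (m * periodMean b₁ T₂ - ε * (l * periodMean a₁ T₁))) :
    ∃ K : ℝ, 0 < K ∧ ∀ s t, 0 ≤ s → s ≤ t →
      Real.exp (-∫ u in s..t, rate S l m ε a b u) ≤ K * Real.exp (-(η * (t - s))) := by
  have hκ := rateConst_pos hS hε
  set κ := rateConst S ε with hκdef
  set A := periodMean a₁ T₁
  set B := periodMean b₁ T₂
  set e := (κ * (m * B - ε * (l * A)) - η) / (κ * (m + ε * l)) with he
  have hD : 0 < κ * (m + ε * l) := by positivity
  have hepos : 0 < e := div_pos (by linarith) hD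
  have hemul : e * (κ * (m + ε * l)) = κ * (m * B - ε * (l * A)) - η := div_mul_cancel₀ _ hD.ne'
  obtain ⟨C₁, h₁⟩ := ha.exists_abs_integral_sub_le hepos
  obtain ⟨C₂, h₂⟩ := hb.exists_abs_integral_sub_le hepos
  refine ⟨Real.exp (κ * (m * C₂ + ε * l * C₁)), Real.exp_pos _, fun s t hs hst => ?_⟩
  have ht := hs.trans hst
  have hIa := intervalIntegrable_of_Ici ha.locallyIntegrable hs ht
  have hIb := intervalIntegrable_of_Ici hb.locallyIntegrable hs ht
  rw [← Real.exp_add, Real.exp_le_exp]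
  have hint : ∫ u in s..t, rate S l m ε a b u =
      κ * (m * (∫ u in s..t, b u) - ε * (l * ∫ u in s..t, a u)) := by
    simp only [rate]
    rw [intervalIntegral.integral_const_mul, intervalIntegral.integral_sub (hIb.const_mul _)
      ((hIa.const_mul _).const_mul _), intervalIntegral.integral_const_mul,
      intervalIntegral.integral_const_mul, intervalIntegral.integral_const_mul]
  have g1 := (abs_le.1 (h₁ s t hs hst)).2
  have g2 := (abs_le.1 (h₂ s t hs hst)).1
  have g3 := mul_le_mul_of_nonneg_left g1 (by positivity : 0 ≤ κ * (ε * l))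
  have g4 := mul_le_mul_of_nonneg_left g2 (by positivity : 0 ≤ κ * m)
  have g5 : e * (κ * (m + ε * l)) * (t - s) = (κ * (m * B - ε * (l * A)) - η) * (t - s) := by
    rw [hemul]
  rw [hint]
  linarith

end

theorem abs_sub_le_abs_tail (x y : ℕ → ℝ) (n : ℕ) :
    |x n - y n| ≤ |tail 0 (fun n => x n - y n) n| + |tail 0 (fun n => x n - y n) (n + 1)| := by
  rw [← tail_sub_tail_succ 0 (fun n => x n - y n) n]
  exact abs_sub _ _

theorem excess_zero (κ : ℝ) (x : ℕ → ℝ) (n : ℕ) : excess 0 κ x n = |tail κ x n| := by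
  rw [excess, sub_zero, max_eq_left (abs_nonneg _)]

/-- The `l¹` distance of two vectors is at most twice the weighted sum of the tails. -/
theorem l1dist_le_of_wsum_le {δ : ℕ → ℝ} (hδ : ∀ k, 1 ≤ δ k) {x y : ℕ → ℝ} {B : ℝ}
    (hB : ∀ N, wsum δ (excess 0 0 fun n => x n - y n) N ≤ B) : l1dist x y ≤ 2 * B := by
  set z := tail 0 fun n => x n - y n with hz
  have hz0 : |z 0| = 0 := by simp [hz, tail]
  refine Real.tsum_le_of_sum_range_le (fun n => abs_nonneg _) fun n => ?_
  have h1 : ∑ k ∈ Finset.range n, |x k - y k| ≤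
      ∑ k ∈ Finset.range n, |z k| + ∑ k ∈ Finset.range n, |z (k + 1)| := by
    rw [← Finset.sum_add_distrib]
    exact Finset.sum_le_sum fun k _ => abs_sub_le_abs_tail x y k
  have h2 : ∑ k ∈ Finset.range n, |z k| ≤ ∑ k ∈ Finset.range (n + 1), |z (k + 1)| := by
    have e1 := Finset.sum_range_succ' (fun k => |z k|) n
    have e2 := Finset.sum_range_succ (fun k => |z k|) n
    have e3 := Finset.sum_range_succ (fun k => |z (k + 1)|) n
    linarith [abs_nonneg (z n), abs_nonneg (z (n + 1))]
  have h3 : ∑ k ∈ Finset.range n, |z (k + 1)| ≤ ∑ k ∈ Finset.range (n + 1), |z (k + 1)| := by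
    rw [Finset.sum_range_succ]
    linarith [abs_nonneg (z (n + 1))]
  have h4 : ∑ k ∈ Finset.range (n + 1), |z (k + 1)| ≤ B := by
    refine le_trans (Finset.sum_le_sum fun k _ => ?_) (hB n)
    rw [excess_zero]
    exact le_mul_of_one_le_left (abs_nonneg _) (one_le_weight hδ k)
  linarith

theorem hasSum_tail {x : ℕ → ℝ} {κ : ℝ} (hx : HasSum x κ) (n : ℕ) :
    HasSum (fun j => if j < n then 0 else x j) (tail κ x n) := by
  have h1 : HasSum (fun j => if j < n then x j else 0) (∑ j ∈ Finset.range n, x j) := by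
    have h := hasSum_sum_of_ne_finset_zero (L := SummationFilter.unconditional ℕ)
      (f := fun j => if j < n then x j else 0) (s := Finset.range n) fun j hj => if_neg fun h => hj (Finset.mem_range.2 h)
    rwa [Finset.sum_congr rfl fun j hj => if_pos (Finset.mem_range.1 hj)] at h
  have h2 := hx.sub h1
  have he : (fun j => if j < n then 0 else x j) = fun j => x j - if j < n then x j else 0 := by
    funext j
    split_ifs <;> simp
  rw [he]
  exact h2

/-- The weighted sum of the tails is at most the `q`-weighted `l¹` norm. -/
theorem wsum_le_tsum_q {δ : ℕ → ℝ} (hδ : ∀ k, 0 < δ k) {x : ℕ → ℝ} (hx : HasSum x 0)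
    (hq : Summable fun i : ℕ => q δ (i + 1) * |x (i + 1)|) (N : ℕ) :
    wsum δ (excess 0 0 x) N ≤ ∑' i : ℕ, q δ (i + 1) * |x (i + 1)| := by
  have hq0 : q δ 0 = 0 := by simp [q]
  have hqs : Summable fun i : ℕ => q δ i * |x i| := (summable_nat_add_iff 1).1 hq
  have htsum : ∑' i : ℕ, q δ i * |x i| = ∑' i : ℕ, q δ (i + 1) * |x (i + 1)| := by
    rw [hqs.tsum_eq_zero_add, hq0, zero_mul, zero_add]
  have habs : Summable fun j => |x j| := hx.summable.abs
  have hs : ∀ k, Summable fun j => if j < k + 1 then 0 else |x j| := fun k =>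
    (hasSum_tail habs.hasSum (k + 1)).summable
  have htail : ∀ k, |tail 0 x (k + 1)| ≤ ∑' j, if j < k + 1 then 0 else |x j| := by
    intro k
    have h := hasSum_tail hx (k + 1)
    have he : (fun j => ‖if j < k + 1 then 0 else x j‖) =
        fun j => if j < k + 1 then 0 else |x j| := by
      funext j
      split_ifs <;> simp
    rw [← h.tsum_eq, ← Real.norm_eq_abs, ← he]
    refine norm_tsum_le_tsum_norm ?_
    rw [he]
    exact hs k
  calc wsum δ (excess 0 0 x) N
      ≤ ∑ k ∈ Finset.range (N + 1), ∑' j, weight δ k * (if j < k + 1 then 0 else |x j|) := by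
        refine Finset.sum_le_sum fun k _ => ?_
        rw [excess_zero, tsum_mul_left]
        exact mul_le_mul_of_nonneg_left (htail k) (weight_pos hδ k).le
    _ = ∑' j, ∑ k ∈ Finset.range (N + 1), weight δ k * (if j < k + 1 then 0 else |x j|) :=
        (Summable.tsum_finsetSum fun k _ => (hs k).mul_left _).symm
    _ ≤ ∑' j, q δ j * |x j| := by
        refine Summable.tsum_le_tsum (fun j => ?_) (summable_sum fun k _ => (hs k).mul_left _) hqs
        rw [q, Finset.sum_mul]
        have h1 : ∀ k, weight δ k * (if j < k + 1 then 0 else |x j|) =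
            if k < j then weight δ k * |x j| else 0 := by
          intro k
          split_ifs <;> first | omega | simp
        simp only [h1]
        rw [← Finset.sum_filter]
        refine Finset.sum_le_sum_of_subset_of_nonneg (fun k hk => ?_) fun k _ _ =>
          mul_nonneg (weight_pos hδ k).le (abs_nonneg _)
        exact Finset.mem_range.2 (Finset.mem_filter.1 hk).2
    _ = _ := htsum

theorem tendsto_tail {x : ℕ → ℝ} {κ : ℝ} (hx : HasSum x κ) : Tendsto (tail κ x) atTop (𝓝 0) := by
  have h := hx.tendsto_sum_nat.const_sub κ
  rwa [sub_self] at h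

/-- The weighted sums of the excess of the tails over a positive level are bounded. -/
theorem exists_wsum_excess_le (δ : ℕ → ℝ) {x : ℕ → ℝ} {η κ : ℝ} (hx : HasSum x κ)
    (hη : 0 < η) : ∃ W, ∀ N, wsum δ (excess η κ x) N ≤ W := by
  have h := (tendsto_tail hx).abs
  rw [abs_zero] at h
  obtain ⟨n, hn⟩ := eventually_atTop.1 (h.eventually (gt_mem_nhds hη))
  have hs : Summable fun k => weight δ k * excess η κ x (k + 1) := by
    refine summable_of_ne_finset_zero (s := Finset.range n) fun k hk => ?_
    have hk' : n ≤ k + 1 := by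
      rw [Finset.mem_range] at hk
      omega
    rw [excess, max_eq_right (by linarith [hn (k + 1) hk']), mul_zero]
  obtain ⟨W, hW⟩ := hs.hasSum.tendsto_sum_nat.bddAbove_range
  exact ⟨W, fun N => hW ⟨N + 1, rfl⟩⟩

theorem l1dist_le_sum_add_tail {x y : ℕ → ℝ} (hx : HasSum x 1) (hy : HasSum y 1)
    (hx0 : ∀ n, 0 ≤ x n) (hy0 : ∀ n, 0 ≤ y n) (n : ℕ) :
    l1dist x y ≤ ∑ k ∈ Finset.range n, |x k - y k| + (tail 1 x n + tail 1 y n) := by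
  have h1 := (hasSum_nat_add_iff' n).2 hx
  have h2 := (hasSum_nat_add_iff' n).2 hy
  have hs : Summable fun k => |x k - y k| := (hx.summable.sub hy.summable).abs
  rw [l1dist, ← hs.sum_add_tsum_nat_add n]
  refine add_le_add_right ?_ _
  refine (Summable.tsum_le_tsum (fun j => ?_) ((summable_nat_add_iff n).2 hs)
    (h1.add h2).summable).trans (le_of_eq (h1.add h2).tsum_eq)
  rw [abs_le]
  constructor <;> linarith [hx0 (j + n), hy0 (j + n)]

theorem antitone_excess {x : ℕ → ℝ} (hx0 : ∀ n, 0 ≤ x n) (hx : ∀ n, 0 ≤ tail 1 x n) (η : ℝ) :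
    Antitone (excess η 1 x) := by
  refine antitone_nat_of_succ_le fun n => max_le_max ?_ le_rfl
  rw [abs_of_nonneg (hx _), abs_of_nonneg (hx _)]
  linarith [tail_sub_tail_succ 1 x n, hx0 n]

section

variable {S : ℕ} {l m ε : ℝ} {a a₁ b b₁ : ℝ → ℝ} {T₁ T₂ : ℝ} {p p₁ p₂ : ℝ → ℕ → ℝ}

/-- The weighted `l¹` bound for the queue with discouragements. -/
theorem wsum_disc_le {r : ℝ} {v : ℝ → ℕ → ℝ}
    (hv : IsSubsolution (discLam S l) (discMu S m) a b r v) (hS : 1 ≤ S) (hl : 0 < l) (hm : 0 < m)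
    (hε₀ : 0 < ε) (hε₁ : ε < 1) (ha : IsAsympPeriodic a a₁ T₁) (hb : IsAsympPeriodic b b₁ T₂)
    {W₀ s t : ℝ} (hs : 0 ≤ s) (hst : s ≤ t) (hW : ∀ N, wsum (discDelta S ε) (v s) N ≤ W₀)
    (N : ℕ) :
    Real.exp (∫ u in s..t, rate S l m ε a b u) * wsum (discDelta S ε) (v t) N ≤
      W₀ + weight (discDelta S ε) 0 * discLam S l 0 * r *
        ∫ u in s..t, Real.exp (∫ x in s..u, rate S l m ε a b x) * a u :=
  wsum_le hv (discLam_nonneg S hl.le) (discLam_le S hl.le) (discMu_zero S m)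
    (discMu_nonneg S hm.le) (discMu_le S hm.le) (one_le_discDelta S hε₀.le)
    (discDelta_le_two S hε₁.le) ha.locallyIntegrable hb.locallyIntegrable ha.nonneg hb.nonneg
    (locallyIntegrableOn_rate ha.locallyIntegrable hb.locallyIntegrable S l m ε)
    (fun k t ht => rate_le_alpha hS hl hm hε₀ hε₁ (ha.nonneg t ht) (hb.nonneg t ht) k)
    hs hst hW N

theorem wsum_disc_sub_le (hS : 1 ≤ S) (hl : 0 < l) (hm : 0 < m) (hε₀ : 0 < ε) (hε₁ : ε < 1)
    (ha : IsAsympPeriodic a a₁ T₁) (hb : IsAsympPeriodic b b₁ T₂)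
    (h₁ : IsStateProb (discLam S l) (discMu S m) a b p₁)
    (h₂ : IsStateProb (discLam S l) (discMu S m) a b p₂) {η : ℝ} (hη : 0 ≤ η)
    {W₀ s t : ℝ} (hs : 0 ≤ s) (hst : s ≤ t)
    (hW : ∀ N, wsum (discDelta S ε) (excess η 0 fun n => p₁ s n - p₂ s n) N ≤ W₀) (N : ℕ) :
    wsum (discDelta S ε) (excess η 0 fun n => p₁ t n - p₂ t n) N ≤
      Real.exp (-∫ u in s..t, rate S l m ε a b u) * W₀ := by
  have h := wsum_disc_le (h₁.isSubsolution_sub h₂ (discMu_zero S m) (discLam_nonneg S hl.le)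
    (discMu_nonneg S hm.le) ha.locallyIntegrable hb.locallyIntegrable ha.nonneg hb.nonneg hη)
    hS hl hm hε₀ hε₁ ha hb hs hst hW N
  rw [mul_zero, zero_mul, add_zero] at h
  rwa [Real.exp_neg, ← div_eq_inv_mul, le_div_iff₀' (Real.exp_pos _)]

theorem l1dist_disc_le (hS : 1 ≤ S) (hl : 0 < l) (hm : 0 < m) (hε₀ : 0 < ε) (hε₁ : ε < 1)
    (ha : IsAsympPeriodic a a₁ T₁) (hb : IsAsympPeriodic b b₁ T₂)
    (h₁ : IsStateProb (discLam S l) (discMu S m) a b p₁)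
    (h₂ : IsStateProb (discLam S l) (discMu S m) a b p₂) {s t : ℝ} (hs : 0 ≤ s) (hst : s ≤ t)
    (hq : Summable fun i : ℕ => q (discDelta S ε) (i + 1) * |p₁ s (i + 1) - p₂ s (i + 1)|) :
    l1dist (p₁ t) (p₂ t) ≤ 2 * (Real.exp (-∫ u in s..t, rate S l m ε a b u) *
      ∑' i : ℕ, q (discDelta S ε) (i + 1) * |p₁ s (i + 1) - p₂ s (i + 1)|) := by
  have hδ := one_le_discDelta S hε₀.le
  have hx : HasSum (fun n => p₁ s n - p₂ s n) 0 := by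
    simpa using (h₁.hasSum_one s hs).sub (h₂.hasSum_one s hs)
  exact l1dist_le_of_wsum_le hδ (wsum_disc_sub_le hS hl hm hε₀ hε₁ ha hb h₁ h₂ le_rfl hs hst
    (wsum_le_tsum_q (fun k => one_pos.trans_le (hδ k)) hx hq))

section

variable {K η : ℝ}

/-- The tails of the difference of two solutions tend to `0` uniformly. -/
theorem eventually_abs_tail_sub_le (hS : 1 ≤ S) (hl : 0 < l) (hm : 0 < m) (hε₀ : 0 < ε)
    (hε₁ : ε < 1) (ha : IsAsympPeriodic a a₁ T₁) (hb : IsAsympPeriodic b b₁ T₂) (hη : 0 < η)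
    (hK : ∀ s t, 0 ≤ s → s ≤ t →
      Real.exp (-∫ u in s..t, rate S l m ε a b u) ≤ K * Real.exp (-(η * (t - s))))
    (h₁ : IsStateProb (discLam S l) (discMu S m) a b p₁)
    (h₂ : IsStateProb (discLam S l) (discMu S m) a b p₂) {θ : ℝ} (hθ : 0 < θ) :
    ∀ᶠ t in atTop, ∀ n, |tail 0 (fun n => p₁ t n - p₂ t n) n| ≤ 2 * θ := by
  have hδ := one_le_discDelta S hε₀.le
  have hx : HasSum (fun n => p₁ 0 n - p₂ 0 n) 0 := by
    simpa using (h₁.hasSum_one 0 le_rfl).sub (h₂.hasSum_one 0 le_rfl)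
  obtain ⟨W, hW⟩ := exists_wsum_excess_le (discDelta S ε) hx hθ
  have hlim : Tendsto (fun t => K * Real.exp (-(η * t)) * W) atTop (𝓝 0) := by
    have h := ((Real.tendsto_exp_neg_atTop_nhds_zero.comp
      (tendsto_id.const_mul_atTop hη)).const_mul K).mul_const W
    simpa using h
  have hW0 : 0 ≤ W := (Finset.sum_nonneg fun k _ => mul_nonneg (zero_le_one.trans
    (one_le_weight hδ k)) (le_max_right _ _)).trans (hW 0)
  filter_upwards [hlim.eventually (gt_mem_nhds hθ), eventually_ge_atTop 0] with t ht ht0 n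
  cases n with
  | zero =>
    simp only [tail, Finset.range_zero, Finset.sum_empty, sub_zero, abs_zero]
    linarith
  | succ n =>
    have e1 := wsum_disc_sub_le hS hl hm hε₀ hε₁ ha hb h₁ h₂ hθ.le le_rfl ht0 hW n
    have e2 := mul_le_mul_of_nonneg_right (hK 0 t le_rfl ht0) hW0
    rw [sub_zero] at e2
    have e3 : excess θ 0 (fun n => p₁ t n - p₂ t n) (n + 1) ≤
        wsum (discDelta S ε) (excess θ 0 fun n => p₁ t n - p₂ t n) n := by
      refine (le_mul_of_one_le_left (le_max_right _ _) (one_le_weight hδ n)).trans ?_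
      exact Finset.single_le_sum
        (f := fun k => weight (discDelta S ε) k * excess θ 0 (fun n => p₁ t n - p₂ t n) (k + 1))
        (fun k _ => mul_nonneg (zero_le_one.trans (one_le_weight hδ k)) (le_max_right _ _))
        (Finset.mem_range.2 (Nat.lt_succ_self n))
    have e4 : |tail 0 (fun n => p₁ t n - p₂ t n) (n + 1)| ≤
        excess θ 0 (fun n => p₁ t n - p₂ t n) (n + 1) + θ :=
      sub_le_iff_le_add.1 (le_max_left _ _)
    linarith

/-- The weighted sums of the excess of the tails of one solution are bounded uniformly in time. -/
theorem exists_wsum_disc_bound (hS : 1 ≤ S) (hl : 0 < l) (hm : 0 < m) (hε₀ : 0 < ε)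
    (hε₁ : ε < 1) (ha : IsAsympPeriodic a a₁ T₁) (hb : IsAsympPeriodic b b₁ T₂) (hη : 0 < η)
    (hK0 : 0 < K)
    (hK : ∀ s t, 0 ≤ s → s ≤ t →
      Real.exp (-∫ u in s..t, rate S l m ε a b u) ≤ K * Real.exp (-(η * (t - s))))
    (h : IsStateProb (discLam S l) (discMu S m) a b p) {θ : ℝ} (hθ : 0 < θ) :
    ∃ B, ∀ t, 0 ≤ t → ∀ N, wsum (discDelta S ε) (excess θ 1 (p t)) N ≤ B := by
  have hδ := one_le_discDelta S hε₀.le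
  have hrate := locallyIntegrableOn_rate ha.locallyIntegrable hb.locallyIntegrable S l m ε
  set δ := discDelta S ε
  have hwnn : ∀ t N, 0 ≤ wsum δ (excess θ 1 (p t)) N := fun t N =>
    Finset.sum_nonneg fun k _ => mul_nonneg (zero_le_one.trans (one_le_weight hδ k))
      (le_max_right _ _)
  obtain ⟨W, hW⟩ := exists_wsum_excess_le δ (h.hasSum_one 0 le_rfl) hθ
  have hW0 : 0 ≤ W := (hwnn 0 0).trans (hW 0)
  obtain ⟨τ, hτ, hτK⟩ : ∃ τ > 0, K * Real.exp (-(η * τ)) ≤ 1 / 2 := by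
    have hlim : Tendsto (fun t => K * Real.exp (-(η * t))) atTop (𝓝 0) := by
      simpa using (Real.tendsto_exp_neg_atTop_nhds_zero.comp
        (tendsto_id.const_mul_atTop hη)).const_mul K
    obtain ⟨τ, h1, h2⟩ := ((hlim.eventually (gt_mem_nhds one_half_pos)).and
      (eventually_gt_atTop 0)).exists
    exact ⟨τ, h2, h1.le⟩
  obtain ⟨C, hC⟩ := ha.exists_abs_integral_sub_le one_pos
  set D := |periodMean a₁ T₁| * τ + (τ + |C|) with hD
  have hID : ∀ s t, 0 ≤ s → s ≤ t → t ≤ s + τ → ∫ u in s..t, a u ≤ D := by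
    intro s t hs hst hts
    have e1 := (abs_le.1 (hC s t hs hst)).2
    have e2 : periodMean a₁ T₁ * (t - s) ≤ |periodMean a₁ T₁| * τ :=
      mul_le_mul (le_abs_self _) (by linarith) (by linarith) (abs_nonneg _)
    linarith [le_abs_self C]
  set G := weight δ 0 * discLam S l 0 * (K * D) with hG
  have hd0 : 0 ≤ weight δ 0 * discLam S l 0 :=
    mul_nonneg (zero_le_one.trans (one_le_weight hδ 0)) (discLam_nonneg S hl.le 0)
  have hD0 : 0 ≤ D := by positivity
  have hG0 : 0 ≤ G := mul_nonneg hd0 (mul_nonneg hK0.le hD0)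
  have hKexp : ∀ s t, 0 ≤ s → s ≤ t → Real.exp (-∫ u in s..t, rate S l m ε a b u) ≤ K := by
    intro s t hs hst
    refine (hK s t hs hst).trans (mul_le_of_le_one_right hK0.le ?_)
    rw [Real.exp_le_one_iff, neg_nonpos]
    exact mul_nonneg hη.le (sub_nonneg.2 hst)
  have hstep : ∀ s t B, 0 ≤ s → s ≤ t → t ≤ s + τ →
      (∀ N, wsum δ (excess θ 1 (p s)) N ≤ B) → ∀ N, wsum δ (excess θ 1 (p t)) N ≤
        Real.exp (-∫ u in s..t, rate S l m ε a b u) * B + G := by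
    intro s t B hs hst hts hB N
    have ht := hs.trans hst
    have key := wsum_disc_le (h.isSubsolution (discMu_zero S m) (discLam_nonneg S hl.le)
      (discMu_nonneg S hm.le) ha.locallyIntegrable hb.locallyIntegrable ha.nonneg hb.nonneg hθ.le)
      hS hl hm hε₀ hε₁ ha hb hs hst hB N
    have hIa := intervalIntegrable_of_Ici ha.locallyIntegrable hs ht
    have hcont : ContinuousOn (fun u => Real.exp (∫ x in s..u, rate S l m ε a b x))
        (Set.uIcc s t) := (absolutelyContinuous_exp ((intervalIntegrable_of_Ici hrate hs
          ht).absolutelyContinuousOnInterval_intervalIntegral (by simp))).continuousOn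
    have hI : ∫ u in s..t, Real.exp (∫ x in s..u, rate S l m ε a b x) * a u ≤
        Real.exp (∫ x in s..t, rate S l m ε a b x) * (K * D) := by
      have e1 : ∫ u in s..t, Real.exp (∫ x in s..u, rate S l m ε a b x) * a u ≤
          ∫ u in s..t, Real.exp (∫ x in s..t, rate S l m ε a b x) * K * a u := by
        refine intervalIntegral.integral_mono_on hst (hIa.continuousOn_mul hcont)
          (hIa.const_mul _) fun u hu => ?_
        have hu0 := hs.trans hu.1
        refine mul_le_mul_of_nonneg_right ?_ (ha.nonneg u hu0)
        have e2 : ∫ x in s..u, rate S l m ε a b x =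
            (∫ x in s..t, rate S l m ε a b x) + -∫ x in u..t, rate S l m ε a b x := by
          rw [← intervalIntegral.integral_add_adjacent_intervals
            (intervalIntegrable_of_Ici hrate hs hu0) (intervalIntegrable_of_Ici hrate hu0 ht)]
          ring
        rw [e2, Real.exp_add]
        exact mul_le_mul_of_nonneg_left (hKexp u t hu0 hu.2) (Real.exp_pos _).le
      rw [intervalIntegral.integral_const_mul, mul_assoc] at e1
      exact e1.trans (mul_le_mul_of_nonneg_left (mul_le_mul_of_nonneg_left
        (hID s t hs hst hts) hK0.le) (Real.exp_pos _).le)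
    have e3 := mul_le_mul_of_nonneg_left hI hd0
    rw [mul_one] at key
    have e4 := mul_le_mul_of_nonneg_left (key.trans (add_le_add_right e3 _))
      (Real.exp_pos (-∫ u in s..t, rate S l m ε a b u)).le
    have e5 : Real.exp (-∫ u in s..t, rate S l m ε a b u) *
        Real.exp (∫ u in s..t, rate S l m ε a b u) = 1 := by
      rw [← Real.exp_add, neg_add_cancel, Real.exp_zero]
    calc wsum δ (excess θ 1 (p t)) N
        = Real.exp (-∫ u in s..t, rate S l m ε a b u) *
            (Real.exp (∫ u in s..t, rate S l m ε a b u) * wsum δ (excess θ 1 (p t)) N) := by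
          rw [← mul_assoc, e5, one_mul]
      _ ≤ _ := e4
      _ = Real.exp (-∫ u in s..t, rate S l m ε a b u) * B +
            Real.exp (-∫ u in s..t, rate S l m ε a b u) *
              Real.exp (∫ u in s..t, rate S l m ε a b u) * G := by
          rw [hG]
          ring
      _ = _ := by rw [e5, one_mul]
  have hgrid : ∀ n : ℕ, ∀ N, wsum δ (excess θ 1 (p (n * τ))) N ≤ W + 2 * G := by
    intro n
    induction n with
    | zero =>
      intro N
      rw [Nat.cast_zero, zero_mul]
      linarith [hW N]
    | succ n ih =>
      intro N
      have hn : 0 ≤ (n : ℝ) * τ := by positivity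
      have hn1 : ((n + 1 : ℕ) : ℝ) * τ = n * τ + τ := by push_cast; ring
      rw [hn1]
      have e1 := hstep (n * τ) (n * τ + τ) _ hn (by linarith) le_rfl ih N
      have e2 := hK (n * τ) (n * τ + τ) hn (by linarith)
      rw [add_sub_cancel_left] at e2
      have e3 := mul_le_mul_of_nonneg_right (e2.trans hτK) (by positivity : 0 ≤ W + 2 * G)
      linarith
  refine ⟨K * (W + 2 * G) + G, fun t ht N => ?_⟩
  have hfl : (⌊t / τ⌋₊ : ℝ) * τ ≤ t := by
    rw [← le_div_iff₀ hτ]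
    exact Nat.floor_le (by positivity)
  have hfl2 : t ≤ ⌊t / τ⌋₊ * τ + τ := by
    have := (Nat.lt_floor_add_one (t / τ)).le
    rw [div_le_iff₀ hτ] at this
    linarith
  have hn : 0 ≤ (⌊t / τ⌋₊ : ℝ) * τ := by positivity
  refine (hstep _ t _ hn hfl hfl2 (hgrid _) N).trans ?_
  exact add_le_add_left (mul_le_mul_of_nonneg_right (hKexp _ t hn hfl) (by positivity)) _

/-- The state probabilities of one process are tight. -/
theorem exists_tail_le (hS : 1 ≤ S) (hl : 0 < l) (hm : 0 < m) (hε₀ : 0 < ε)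
    (hε₁ : ε < 1) (ha : IsAsympPeriodic a a₁ T₁) (hb : IsAsympPeriodic b b₁ T₂) (hη : 0 < η)
    (hK0 : 0 < K)
    (hK : ∀ s t, 0 ≤ s → s ≤ t →
      Real.exp (-∫ u in s..t, rate S l m ε a b u) ≤ K * Real.exp (-(η * (t - s))))
    (h : IsStateProb (discLam S l) (discMu S m) a b p) {θ : ℝ} (hθ : 0 < θ) :
    ∃ n₀, ∀ n, n₀ ≤ n → ∀ t, 0 ≤ t → tail 1 (p t) n ≤ 2 * θ := by
  have hδ := one_le_discDelta S hε₀.le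
  obtain ⟨B, hB⟩ := exists_wsum_disc_bound hS hl hm hε₀ hε₁ ha hb hη hK0 hK h hθ
  obtain ⟨N, hN⟩ := exists_nat_ge (B / θ)
  rw [div_le_iff₀ hθ] at hN
  refine ⟨N + 1, fun n hn t ht => ?_⟩
  have hanti := antitone_excess (h.nonneg t ht) (fun n => (h.tail_mem ht n).1) θ
  have h1 : ((N + 1 : ℕ) : ℝ) * excess θ 1 (p t) (N + 1) ≤ B := by
    refine le_trans ?_ (hB t ht N)
    rw [← nsmul_eq_mul]
    refine (le_of_eq (by rw [Finset.card_range])).trans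
      (Finset.card_nsmul_le_sum (Finset.range (N + 1)) _ (excess θ 1 (p t) (N + 1))
        fun k hk => ?_)
    exact (hanti (by have := Finset.mem_range.1 hk; omega)).trans
      (le_mul_of_one_le_left (le_max_right _ _) (one_le_weight hδ k))
  have h2 : excess θ 1 (p t) (N + 1) ≤ θ := by
    by_contra hlt
    rw [not_le] at hlt
    have h3 := mul_lt_mul_of_pos_left hlt (by positivity : (0 : ℝ) < ((N + 1 : ℕ) : ℝ))
    push_cast at h1 h3
    linarith
  have h4 := (le_max_left (|tail 1 (p t) n| - θ) 0).trans ((hanti hn).trans h2)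
  linarith [le_abs_self (tail 1 (p t) n)]

theorem weaklyErgodic_disc (hS : 1 ≤ S) (hl : 0 < l) (hm : 0 < m) (hε₀ : 0 < ε)
    (hε₁ : ε < 1) (ha : IsAsympPeriodic a a₁ T₁) (hb : IsAsympPeriodic b b₁ T₂)
    (hmean : 0 < m * periodMean b₁ T₂ - ε * (l * periodMean a₁ T₁)) :
    WeaklyErgodic (discLam S l) (discMu S m) a b := by
  intro p₁ p₂ h₁ h₂
  have hr := mul_pos (rateConst_pos hS hε₀) hmean
  obtain ⟨K, hK0, hK⟩ := exists_exp_rate_le hS hl hm hε₀ ha hb (half_lt_self hr)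
  have hη := half_pos hr
  rw [Metric.tendsto_atTop]
  suffices H : ∀ θ > 0, ∀ᶠ t in atTop, l1dist (p₁ t) (p₂ t) ≤ 8 * θ by
    intro e he
    obtain ⟨t₀, ht₀⟩ := eventually_atTop.1 (H (e / 16) (by positivity))
    refine ⟨t₀, fun t ht => ?_⟩
    have h0 : 0 ≤ l1dist (p₁ t) (p₂ t) := tsum_nonneg fun n => abs_nonneg _
    rw [Real.dist_eq, sub_zero, abs_of_nonneg h0]
    linarith [ht₀ t ht]
  intro θ hθ
  obtain ⟨n₁, hn₁⟩ := exists_tail_le hS hl hm hε₀ hε₁ ha hb hη hK0 hK h₁ hθ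
  obtain ⟨n₂, hn₂⟩ := exists_tail_le hS hl hm hε₀ hε₁ ha hb hη hK0 hK h₂ hθ
  set n := max n₁ n₂
  have hn0 : (0 : ℝ) < n + 1 := by positivity
  filter_upwards [eventually_abs_tail_sub_le hS hl hm hε₀ hε₁ ha hb hη hK h₁ h₂
    (div_pos hθ hn0), eventually_ge_atTop 0] with t ht ht0
  refine (l1dist_le_sum_add_tail (h₁.hasSum_one t ht0) (h₂.hasSum_one t ht0) (h₁.nonneg t ht0)
    (h₂.nonneg t ht0) n).trans ?_
  have e1 : ∑ k ∈ Finset.range n, |p₁ t k - p₂ t k| ≤ n * (4 * (θ / (n + 1))) := by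
    refine (Finset.sum_le_card_nsmul _ _ (4 * (θ / (n + 1))) fun k _ => ?_).trans
      (le_of_eq (by simp))
    linarith [abs_sub_le_abs_tail (p₁ t) (p₂ t) k, ht k, ht (k + 1)]
  have e2 : (n : ℝ) * (4 * (θ / (n + 1))) ≤ 4 * θ := by
    have : (n : ℝ) * (4 * (θ / (n + 1))) = 4 * θ * (n / (n + 1)) := by ring
    rw [this]
    exact mul_le_of_le_one_right (by positivity) ((div_le_one hn0).2 (by linarith))
  linarith [hn₁ n (le_max_left _ _) t ht0, hn₂ n (le_max_right _ _) t ht0]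

end

end

end BDP

theorem mainTheorem10 (S : ℕ) (hS : 1 ≤ S) (l m : ℝ) (hl : 0 < l) (hm : 0 < m)
    (a a₁ b b₁ : ℝ → ℝ) (T₁ T₂ : ℝ)
    (ha : BDP.IsAsympPeriodic a a₁ T₁) (hb : BDP.IsAsympPeriodic b b₁ T₂)
    (ε : ℝ) (hε₀ : 0 < ε) (hε₁ : ε < 1)
    (hmean : 0 < m * BDP.periodMean b₁ T₂ - ε * (l * BDP.periodMean a₁ T₁)) :
    -- the rate function in closed form, for all small `ε`
    (((S : ℝ) - 1) * ε ≤ 1 → ∀ t, BDP.rate S l m ε a b t =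
      (S : ℝ) * ε / (1 + ε) * (m * b t - ε * (l * a t))) ∧
    -- the lower bound for every `α_k(t)`
    (∀ k : ℕ, ∀ t, 0 ≤ t →
      BDP.rate S l m ε a b t ≤
        BDP.alpha (BDP.discLam S l) (BDP.discMu S m) (BDP.discDelta S ε) a b k t) ∧
    -- the `l¹` bound with this rate function
    (∀ p₁ p₂ : ℝ → ℕ → ℝ,
      BDP.IsStateProb (BDP.discLam S l) (BDP.discMu S m) a b p₁ →
      BDP.IsStateProb (BDP.discLam S l) (BDP.discMu S m) a b p₂ →
      ∀ s t, 0 ≤ s → s ≤ t →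
      Summable (fun i : ℕ => BDP.q (BDP.discDelta S ε) (i + 1) * |p₁ s (i + 1) - p₂ s (i + 1)|) →
      BDP.l1dist (p₁ t) (p₂ t) ≤
        4 * Real.exp (-∫ u in s..t, BDP.rate S l m ε a b u) *
          ∑' i : ℕ, BDP.q (BDP.discDelta S ε) (i + 1) * |p₁ s (i + 1) - p₂ s (i + 1)|) ∧
    -- the rate is exponential
    (∀ η : ℝ,
      η < BDP.rateConst S ε * (m * BDP.periodMean b₁ T₂ - ε * (l * BDP.periodMean a₁ T₁)) →
      ∃ K : ℝ, 0 < K ∧ ∀ s t, 0 ≤ s → s ≤ t →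
        Real.exp (-∫ u in s..t, BDP.rate S l m ε a b u) ≤ K * Real.exp (-(η * (t - s)))) ∧
    -- weak ergodicity
    BDP.WeaklyErgodic (BDP.discLam S l) (BDP.discMu S m) a b := by
  refine ⟨fun h t => ?_, fun k t ht => BDP.rate_le_alpha hS hl hm hε₀ hε₁ (ha.nonneg t ht)
    (hb.nonneg t ht) k, fun p₁ p₂ h₁ h₂ s t hs hst hq => ?_,
    fun η hη => BDP.exists_exp_rate_le hS hl hm hε₀ ha hb hη,
    BDP.weaklyErgodic_disc hS hl hm hε₀ hε₁ ha hb hmean⟩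
  · rw [BDP.rate, BDP.rateConst_eq hε₀ h]
  · have key := BDP.l1dist_disc_le hS hl hm hε₀ hε₁ ha hb h₁ h₂ hs hst hq
    have hq0 : 0 ≤ ∑' i : ℕ, BDP.q (BDP.discDelta S ε) (i + 1) * |p₁ s (i + 1) - p₂ s (i + 1)| :=
      tsum_nonneg fun i => mul_nonneg (Finset.sum_nonneg fun j _ => (BDP.weight_pos (fun k =>
        one_pos.trans_le (BDP.one_le_discDelta S hε₀.le k)) j).le) (abs_nonneg _)
    have h0 := mul_nonneg (Real.exp_pos (-∫ u in s..t, BDP.rate S l m ε a b u)).le hq0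
    linarith
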